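/- An edge-ordered graph is a finite simple graph together with a linear order on its edge set. An edge-ordered graph $G$ contains an edge-ordered graph $H$ if $H$ is isomorphic, by an isomorphism respecting the edge-orders, to a (not necessarily induced) subgraph of $G$ with the induced edge-order; otherwise $G$ avoids $H$. It avoids a family if it avoids every member. All members of a family are assumed to have at least one edge. A finite simple graph can avoid a family $\mathcal H$ if some linear order on its edges makes it an edge-ordered graph avoiding $\mathcal H$. The order chromatic number $\chi'_<(\mathcal H)$ is the smallest chromatic number of a finite simple graph that cannot avoid $\mathcal H$, and $\chi'_<(\mathcal H)=\infty$ if every finite simple graph can avoid $\mathcal H$; write $\chi'_<(G)=\chi'_<(\{G\})$. Let $K_{n,n}^{\mathrm{can}}$ be the complete bipartite graph with classes $\{u_1,\dots,u_n\}$ and $\{v_1,\dots,v_n\}$ whose edges are ordered by the labels $L(u_iv_j)=ni+j$. Let $\mathcal H$ be a family of edge-ordered graphs, each having at least one edge. 1. For every subfamily $\mathcal H'\subseteq\mathcal H$ we have $\chi'_<(\mathcal H')\ge\chi'_<(\mathcal H)$. 2. $\chi'_<(\mathcal H)=2$ if and only if there exists $G\in\mathcal H$ with $\chi'_<(G)=2$.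 3. For an edge-ordered graph $G$ on $n$ vertices with at least one edge, $\chi'_<(G)=2$ if and only if $K_{n,n}^{\mathrm{can}}$ contains $G$. 4. If $\chi'_<(\mathcal H)$ is finite, then there exists a subfamily $\mathcal H'\subseteq\mathcal H$ of size at most four with $\chi'_<(\mathcal H')$ finite. 5. For every integer $k\ge3$ there exists a number $c_k$, depending only on $k$, such that for every family $\mathcal H$ as above with $\chi'_<(\mathcal H)=k$ there is a subfamily $\mathcal H'\subseteq\mathcal H$ of size at most $c_k$ with $\chi'_<(\mathcal H')=k$. One can choose $c_3=80$. -/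

import Mathlib

universe u v

/-- An edge-ordered graph: a finite simple graph with a linear order on its edge set. -/
structure EdgeOrderedGraph where
  /-- the vertex set -/
  V : Type u
  /-- there are finitely many vertices -/
  finite : Finite V
  /-- the underlying simple graph -/
  graph : SimpleGraph V
  /-- the linear order on the edges -/
  edgeOrder : LinearOrder graph.edgeSet

namespace EdgeOrderedGraph

/-- The edge-ordered graph has at least one edge. -/
def HasEdge (G : EdgeOrderedGraph.{u}) : Prop := G.graph.edgeSet.Nonempty

/-- `G.Contains H`: some injective graph homomorphism from `H` to `G` preserves the edge-order,
i.e. `H` is isomorphic to a (not necessarily induced) subgraph of `G`, which carries the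
edge-order inherited from `G`. -/
def Contains (G : EdgeOrderedGraph.{u}) (H : EdgeOrderedGraph.{v}) : Prop :=
  ∃ f : SimpleGraph.Copy H.graph G.graph, ∀ e e' : H.graph.edgeSet,
    H.edgeOrder.lt e e' ↔ G.edgeOrder.lt (f.toHom.mapEdgeSet e) (f.toHom.mapEdgeSet e')

/-- `G` avoids a family if it contains no member of the family. -/
def Avoids (G : EdgeOrderedGraph.{u}) (ℋ : Set EdgeOrderedGraph.{v}) : Prop :=
  ∀ H ∈ ℋ, ¬ G.Contains H

end EdgeOrderedGraph

/-- The finite simple graph `G` can avoid the family `ℋ`: some edge-ordering of `G` avoids `ℋ`. -/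
def CanAvoid {V : Type v} [hV : Finite V] (G : SimpleGraph V)
    (ℋ : Set EdgeOrderedGraph.{u}) : Prop :=
  ∃ o : LinearOrder G.edgeSet, EdgeOrderedGraph.Avoids ⟨V, hV, G, o⟩ ℋ

/-- The order chromatic number of `ℋ`: the least chromatic number of a finite simple graph that
cannot avoid `ℋ`, and `⊤` if there is no such graph. -/
noncomputable def orderChromaticNumber (ℋ : Set EdgeOrderedGraph.{u}) : ℕ∞ :=
  sInf {c : ℕ∞ | ∃ (V : Type) (_ : Finite V) (G : SimpleGraph V),
    ¬ CanAvoid G ℋ ∧ G.chromaticNumber = c}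

/-- The labels of `K_{n,n}^can`. With `i` and `j` running from `0` to `n - 1`, the edge joining the
`(i + 1)`-st left vertex and the `(j + 1)`-st right vertex gets the label `n (i + 1) + (j + 1)`. The
values on pairs that are not edges are irrelevant. -/
def canonicalLabel (n : ℕ) : Sym2 (Fin n ⊕ Fin n) → ℕ :=
  Sym2.lift ⟨fun x y => match x, y with
    | .inl i, .inr j => n * (i.val + 1) + (j.val + 1)
    | .inr j, .inl i => n * (i.val + 1) + (j.val + 1)
    | .inl _, .inl _ => 0
    | .inr _, .inr _ => 0, by
      rintro (i | i) (j | j) <;> rfl⟩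

theorem canonicalLabel_injective (n : ℕ) : Function.Injective
    (fun e : (completeBipartiteGraph (Fin n) (Fin n)).edgeSet => canonicalLabel n e.val) := by
  have key : ∀ i j i' j' : Fin n,
      n * (i.val + 1) + (j.val + 1) = n * (i'.val + 1) + (j'.val + 1) → i = i' ∧ j = j' := by
    intro i j i' j' h
    have h1 : n * i.val + j.val = n * i'.val + j'.val := by
      have h2 : n * (i.val + 1) = n * i.val + n := by ring
      have h3 : n * (i'.val + 1) = n * i'.val + n := by ring
      omega
    have hpos : 0 < n := lt_of_le_of_lt (Nat.zero_le _) i.isLt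
    have hi : i.val = i'.val := by
      have := congrArg (· / n) h1
      simpa [Nat.mul_add_div hpos, Nat.div_eq_of_lt i.isLt, Nat.div_eq_of_lt j.isLt,
        Nat.div_eq_of_lt j'.isLt] using this
    have hj : j.val = j'.val := by
      rw [hi] at h1
      omega
    exact ⟨Fin.ext hi, Fin.ext hj⟩
  rintro ⟨e, he⟩ ⟨e', he'⟩ h
  induction e using Sym2.ind with
  | _ x y =>
  induction e' using Sym2.ind with
  | _ z w =>
  apply Subtype.ext
  rcases x with i | i <;> rcases y with j | j <;> rcases z with k | k <;> rcases w with l | l <;>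
    first
    | (exfalso; simp at he; done)
    | (exfalso; simp at he'; done)
    | (obtain ⟨rfl, rfl⟩ := key _ _ _ _ h
       first
       | rfl
       | exact Sym2.eq_swap)

/-- The edge-ordered complete bipartite graph `K_{n,n}^can`: its edges are ordered by their
labels, that is, lexicographically, first by the left and then by the right end vertex. -/
noncomputable def canonicalBipartite (n : ℕ) : EdgeOrderedGraph.{0} where
  V := Fin n ⊕ Fin n
  finite := inferInstance
  graph := completeBipartiteGraph (Fin n) (Fin n)
  edgeOrder := LinearOrder.lift' (fun e => canonicalLabel n e.val) (canonicalLabel_injective n)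

/-!
The proof finds, in every edge-order of a large host graph, a copy of a smaller host graph with a
*homogeneous* edge-order, in which the comparison of two edges depends only on the classes of their
end vertices and on the relative position of the vertices within each class, and then classifies the
homogeneous orders up to automorphisms of the host.

The host graphs are the complete graphs, as one class with all edges, and the complete `k`-partite
graphs. A graph of chromatic number `k` that cannot avoid a family can be replaced by a complete
`k`-partite one (`not_canAvoid_multipartite`). Homogeneous copies come from Ramsey's theorem for
4-tuples (`exists_homogeneous`). If the homogeneous orders of a host that cannot avoid `ℋ` fall into
`c` types, then one member of `ℋ` for each type suffices, since a larger host cannot avoid these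
(`exists_subfamily`). So the bounds are numbers of types:

* On a complete bipartite graph there is a single type, that of the canonical order
  (`contains_canonicalBipartite`): reversing the numbering of a class or exchanging the classes
  makes any lexicographic order canonical. This gives the statements about the value 2. A copy of
  `G` in a canonical order needs no more than `|V(G)|` vertices on either side.
* On a complete graph there are four types (`exists_follows_completeLt`).
* On a complete tripartite graph there are at most 80 (`exists_follows_normalOrder`). Between any
  two classes the order is lexicographic. The edges between two of the three pairs of classes
  are either separated or alternate, and in the latter case the common class is primary and has the
  same direction for both. If no two pairs alternate, one may permute the classes so that the pairs
  follow each other in the order `01`, `02`, `12`; there remain three choices of primary classes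
  and, after fixing one direction in each class, three directions: 64 types. If two pairs alternate,
  these may be taken as `01` and `02`, with `01` first at a common vertex; there remain whether `12`
  comes before or after them, its primary class, and its two directions: 16 types.
* For arbitrary `k` it suffices that there are finitely many comparison patterns (`pattern`).
-/

namespace OrderChromatic

/-! ### Ramsey's theorem for subsets and for tuples -/

/-- Finite Ramsey theorem for `r`-element sets of natural numbers and finitely many colours. -/
theorem exists_homogeneous_subset (r : ℕ) : ∀ (n : ℕ) (κ : Type) [Finite κ],
    ∃ N : ℕ, ∀ (χ : Finset ℕ → κ) (S : Finset ℕ), N ≤ S.card →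
      ∃ T ⊆ S, T.card = n ∧ ∃ c, ∀ A ⊆ T, A.card = r → χ A = c := by
  induction r with
  | zero =>
    intro n κ _
    refine ⟨n, fun χ S hS => ?_⟩
    obtain ⟨T, hT, hc⟩ := Finset.exists_subset_card_eq hS
    exact ⟨T, hT, hc, χ ∅, fun A _ hA => by rw [Finset.card_eq_zero.1 hA]⟩
  | succ r ih =>
    intro n κ _
    -- first make the colour of a set depend on its least element only
    have key : ∀ m : ℕ, ∃ N : ℕ, ∀ (χ : Finset ℕ → κ) (S : Finset ℕ), N ≤ S.card →
        ∃ T ⊆ S, T.card = m ∧ ∃ f : ℕ → κ, ∀ x ∈ T, ∀ A ⊆ T, (∀ y ∈ A, x < y) →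
          A.card = r → χ (insert x A) = f x := by
      intro m
      induction m with
      | zero =>
        exact ⟨0, fun χ S _ => ⟨∅, by simp, rfl, fun _ => χ ∅, by simp⟩⟩
      | succ m ihm =>
        obtain ⟨N₁, h₁⟩ := ihm
        obtain ⟨N₂, h₂⟩ := ih N₁ κ
        refine ⟨N₂ + 1, fun χ S hS => ?_⟩
        have hne : S.Nonempty := Finset.card_pos.1 (by omega)
        set x := S.min' hne with hx
        have hxS : x ∈ S := Finset.min'_mem _ _
        obtain ⟨T₂, hT₂, hc₂, c, hc⟩ := h₂ (fun A => χ (insert x A)) (S.erase x)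
          (by rw [Finset.card_erase_of_mem hxS]; omega)
        obtain ⟨T₁, hT₁, hc₁, f, hf⟩ := h₁ χ T₂ hc₂.ge
        have hlt : ∀ y ∈ T₁, x < y := fun y hy =>
          Finset.min'_lt_of_mem_erase_min' S hne (hT₂ (hT₁ hy))
        have hxT : x ∉ T₁ := fun h => lt_irrefl _ (hlt x h)
        refine ⟨insert x T₁, ?_, by rw [Finset.card_insert_of_notMem hxT, hc₁],
          Function.update f x c, ?_⟩
        · exact Finset.insert_subset hxS
            (hT₁.trans (hT₂.trans (Finset.erase_subset _ _)))
        · intro y hy A hA hyA hAc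
          have hxA : x ∉ A := by
            intro h
            have h1 := hyA x h
            rcases Finset.mem_insert.1 hy with rfl | hy'
            · exact lt_irrefl _ h1
            · exact lt_asymm h1 (hlt y hy')
          have hA' : A ⊆ T₁ := fun z hz =>
            (Finset.mem_insert.1 (hA hz)).resolve_left (fun h => hxA (h ▸ hz))
          rcases Finset.mem_insert.1 hy with rfl | hy'
          · rw [Function.update_self]
            exact hc A (hA'.trans hT₁) hAc
          · rw [Function.update_of_ne (hlt y hy').ne']
            exact hf y hy' A hA' hyA hAc
    classical
    have := Fintype.ofFinite κ
    obtain ⟨N, hN⟩ := key (Fintype.card κ * n)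
    refine ⟨N, fun χ S hS => ?_⟩
    obtain ⟨T, hTS, hTc, f, hf⟩ := hN χ S hS
    have : Nonempty κ := ⟨χ ∅⟩
    obtain ⟨c, -, hc⟩ := Finset.exists_le_card_fiber_of_mul_le_card_of_maps_to
      (s := T) (t := (Finset.univ : Finset κ)) (f := f) (n := n) (fun _ _ => Finset.mem_univ _)
      Finset.univ_nonempty (by rw [hTc, Finset.card_univ])
    obtain ⟨T', hT', hc'⟩ := Finset.exists_subset_card_eq hc
    refine ⟨T', hT'.trans ((Finset.filter_subset _ _).trans hTS), hc', c, fun A hA hAc => ?_⟩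
    have hne : A.Nonempty := Finset.card_pos.1 (by omega)
    have hmem : A.min' hne ∈ A := Finset.min'_mem _ _
    have hsub : A ⊆ T := hA.trans (hT'.trans (Finset.filter_subset _ _))
    rw [← Finset.insert_erase hmem, hf _ (hsub hmem) _ ((Finset.erase_subset _ _).trans hsub)
      (fun y hy => Finset.min'_lt_of_mem_erase_min' A hne hy)
      (by rw [Finset.card_erase_of_mem hmem]; omega)]
    exact (Finset.mem_filter.1 (hT' (hA hmem))).2

/-- Ramsey's theorem for tuples that may have repeated entries and come in any order: on a suitable
subset, the colour of a tuple depends only on the order pattern of its entries. -/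
theorem exists_homogeneous_tuple (r n : ℕ) (κ : Type) [Finite κ] :
    ∃ N : ℕ, ∀ χ : (Fin r → ℕ) → κ, ∃ φ : Fin n → ℕ, StrictMono φ ∧ (∀ i, φ i < N) ∧
      ∀ p q : Fin r → Fin n, (∀ s t, p s < p t ↔ q s < q t) → χ (φ ∘ p) = χ (φ ∘ q) := by
  classical
  obtain ⟨N, hN⟩ := exists_homogeneous_subset r (n + r) ((Fin r → Fin r) → κ)
  refine ⟨N, fun χ => ?_⟩
  -- a set is coloured by the colours of all tuples of its elements
  obtain ⟨T, hTS, hTc, c, hc⟩ := hN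
    (fun A t => χ fun s => if h : A.card = r then A.orderEmbOfFin h (t s) else 0)
    (Finset.range N) (by simp)
  set e := T.orderEmbOfFin hTc with he
  have heT : ∀ i, e i ∈ T := fun i => Finset.orderEmbOfFin_mem _ _ _
  let φ : Fin n → ℕ := fun i => e (Fin.castAdd r i)
  have hφ : StrictMono φ := fun i j h => e.strictMono (Fin.lt_def.2 h)
  -- the last `r` elements of `T` fill up tuples with repeated entries to sets of size `r`
  let top : Finset ℕ := Finset.univ.image fun i : Fin r => e (Fin.natAdd n i)
  have htop : ∀ x ∈ top, ∀ i, φ i < x := by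
    intro x hx i
    obtain ⟨j, -, rfl⟩ := Finset.mem_image.1 hx
    exact e.strictMono (Fin.lt_def.2 (by rw [Fin.val_castAdd, Fin.val_natAdd]; omega))
  have htopc : top.card = r := by
    rw [Finset.card_image_of_injective _
      (fun i j h => Fin.natAdd_injective _ _ (e.injective h))]
    simp
  have htopT : top ⊆ T := by
    intro x hx
    obtain ⟨j, -, rfl⟩ := Finset.mem_image.1 hx
    exact heT _
  refine ⟨φ, hφ, fun i => Finset.mem_range.1 (hTS (heT _)), fun p q hpq => ?_⟩
  obtain ⟨A, hA₁, hA₂, hAc⟩ := Finset.exists_subsuperset_card_eq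
    (s := Finset.univ.image (φ ∘ p)) (t := Finset.univ.image (φ ∘ p) ∪ top) (n := r)
    Finset.subset_union_left (Finset.card_image_le.trans (by simp))
    (htopc.ge.trans (Finset.card_le_card Finset.subset_union_right))
  let g : ℕ → ℕ := fun x => if h : ∃ s, φ (p s) = x then φ (q h.choose) else x
  have hg₁ : ∀ s, g (φ (p s)) = φ (q s) := by
    intro s
    have h : ∃ s', φ (p s') = φ (p s) := ⟨s, rfl⟩
    have h1 : p h.choose = p s := hφ.injective h.choose_spec
    have h2 : q h.choose = q s := by
      have a := hpq h.choose s
      have b := hpq s h.choose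
      rw [h1] at a b
      simp only [lt_irrefl, false_iff, not_lt] at a b
      exact le_antisymm b a
    simp only [g, dif_pos h, h2]
  have hg₂ : ∀ x ∈ top, g x = x := by
    intro x hx
    have h : ¬ ∃ s, φ (p s) = x := by
      rintro ⟨s, rfl⟩
      exact lt_irrefl _ (htop _ hx (p s))
    simp only [g, dif_neg h]
  have hA : ∀ x ∈ A, (∃ s, φ (p s) = x) ∨ x ∈ top := by
    intro x hx
    rcases Finset.mem_union.1 (hA₂ hx) with h | h
    · obtain ⟨s, -, rfl⟩ := Finset.mem_image.1 h
      exact Or.inl ⟨s, rfl⟩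
    · exact Or.inr h
  have hgm : StrictMonoOn g A := by
    intro x hx y hy hxy
    rcases hA x hx with ⟨s, rfl⟩ | hx' <;> rcases hA y hy with ⟨t, rfl⟩ | hy'
    · rw [hg₁, hg₁]
      exact hφ ((hpq s t).1 (hφ.lt_iff_lt.1 hxy))
    · rw [hg₁, hg₂ _ hy']
      exact htop _ hy' _
    · exact absurd (htop _ hx' (p t)) (not_lt.2 hxy.le)
    · rwa [hg₂ _ hx', hg₂ _ hy']
  have hBc : (A.image g).card = r := by rw [Finset.card_image_of_injOn hgm.injOn, hAc]
  have hgT : ∀ x ∈ A, g x ∈ T := by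
    intro x hx
    rcases hA x hx with ⟨s, rfl⟩ | hx'
    · rw [hg₁]; exact heT _
    · rw [hg₂ _ hx']; exact htopT hx'
  have hAT : A ⊆ T := by
    intro x hx
    rcases hA x hx with ⟨s, rfl⟩ | hx'
    · exact heT _
    · exact htopT hx'
  -- `g` is the increasing bijection from `A` onto its image
  have hemb : ∀ i, (A.image g).orderEmbOfFin hBc i = g (A.orderEmbOfFin hAc i) := by
    intro i
    refine (congrFun (Finset.orderEmbOfFin_unique hBc
      (f := fun i => g (A.orderEmbOfFin hAc i)) (fun i => ?_) (fun i j hij => ?_)) i).symm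
    · exact Finset.mem_image_of_mem _ (Finset.orderEmbOfFin_mem _ _ _)
    · exact hgm (Finset.orderEmbOfFin_mem _ _ _) (Finset.orderEmbOfFin_mem _ _ _)
        ((A.orderEmbOfFin hAc).strictMono hij)
  have hmemA : ∀ s, φ (p s) ∈ A := fun s => hA₁ (Finset.mem_image_of_mem _ (Finset.mem_univ s))
  have hex : ∀ s, ∃ i, A.orderEmbOfFin hAc i = φ (p s) := by
    intro s
    have : φ (p s) ∈ Set.range (A.orderEmbOfFin hAc) := by
      rw [Finset.range_orderEmbOfFin]; exact hmemA s
    exact this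
  choose t ht using hex
  have h := congrFun ((hc A hAT hAc).trans
    (hc (A.image g) (Finset.image_subset_iff.2 hgT) hBc).symm) t
  simp only [dif_pos hAc, dif_pos hBc, hemb, ht, hg₁] at h
  exact h

/-! ### Edge-orders given by labels -/

/-- The edge-ordered graph whose edges are ordered by natural number labels. Labels of pairs that
are not edges are irrelevant. -/
noncomputable def ofLabel {V : Type v} [hV : Finite V] (G : SimpleGraph V) (ℓ : Sym2 V → ℕ)
    (h : Set.InjOn ℓ G.edgeSet) : EdgeOrderedGraph.{v} where
  V := V
  finite := hV
  graph := G
  edgeOrder := LinearOrder.lift' (fun e : G.edgeSet => ℓ e.val)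
    (fun e f hef => Subtype.ext (h e.2 f.2 hef))

theorem exists_strictMono_nat (α : Type*) [Finite α] [LinearOrder α] :
    ∃ rk : α → ℕ, StrictMono rk :=
  ⟨fun x => (Set.Iio x).ncard, fun _ y hxy =>
    Set.ncard_lt_ncard (Set.Iio_ssubset_Iio hxy) (Set.toFinite (Set.Iio y))⟩

theorem exists_eq_ofLabel {V : Type v} [hV : Finite V] (G : SimpleGraph V)
    (o : LinearOrder G.edgeSet) :
    ∃ (ℓ : Sym2 V → ℕ) (h : Set.InjOn ℓ G.edgeSet),
      (⟨V, hV, G, o⟩ : EdgeOrderedGraph.{v}) = ofLabel G ℓ h := by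
  classical
  obtain ⟨rk, hrk⟩ := @exists_strictMono_nat G.edgeSet _ o
  let ℓ : Sym2 V → ℕ := fun e => if h : e ∈ G.edgeSet then rk ⟨e, h⟩ else 0
  have hℓ : ∀ e : G.edgeSet, ℓ e.val = rk e := fun e => by simp [ℓ]
  have hinj : Set.InjOn ℓ G.edgeSet := by
    intro e he f hf hef
    have : rk ⟨e, he⟩ = rk ⟨f, hf⟩ := by rw [← hℓ, ← hℓ]; exact hef
    exact congrArg Subtype.val (@StrictMono.injective _ _ o _ rk hrk _ _ this)
  refine ⟨ℓ, hinj, ?_⟩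
  unfold ofLabel
  congr 1
  refine LinearOrder.ext_lt fun e f => ?_
  change o.lt e f ↔ ℓ e.val < ℓ f.val
  rw [hℓ, hℓ]
  exact (@StrictMono.lt_iff_lt _ _ o _ rk hrk e f).symm

theorem not_canAvoid_iff {V : Type v} [Finite V] {G : SimpleGraph V}
    {ℋ : Set EdgeOrderedGraph.{u}} :
    ¬ CanAvoid G ℋ ↔ ∀ (ℓ : Sym2 V → ℕ) (h : Set.InjOn ℓ G.edgeSet),
      ∃ H ∈ ℋ, (ofLabel G ℓ h).Contains H := by
  simp only [CanAvoid, EdgeOrderedGraph.Avoids, not_exists, not_forall, not_not, exists_prop]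
  constructor
  · exact fun h ℓ hℓ => h (ofLabel G ℓ hℓ).edgeOrder
  · intro h o
    obtain ⟨ℓ, hℓ, heq⟩ := exists_eq_ofLabel G o
    rw [heq]
    exact h ℓ hℓ

theorem Contains.trans {F : EdgeOrderedGraph.{u}} {G : EdgeOrderedGraph.{v}}
    {H : EdgeOrderedGraph} (hFG : F.Contains G) (hGH : G.Contains H) : F.Contains H := by
  obtain ⟨f, hf⟩ := hFG
  obtain ⟨g, hg⟩ := hGH
  refine ⟨f.comp g, fun e e' => ?_⟩
  have hcomp : ∀ e : H.graph.edgeSet,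
      (f.comp g).toHom.mapEdgeSet e = f.toHom.mapEdgeSet (g.toHom.mapEdgeSet e) := by
    rintro ⟨e, he⟩
    apply Subtype.ext
    induction e using Sym2.ind with
    | _ x y => rfl
  rw [hcomp, hcomp, hg, hf]

/-- An injective homomorphism that increases labels is a containment: since all labels of edges are
distinct, it then also reflects the order. -/
theorem ofLabel_contains_ofLabel {V : Type u} {W : Type v} [Finite V] [Finite W]
    {G : SimpleGraph V} {H : SimpleGraph W} {ℓ : Sym2 V → ℕ} {ℓ' : Sym2 W → ℕ}
    (hℓ : Set.InjOn ℓ G.edgeSet) (hℓ' : Set.InjOn ℓ' H.edgeSet) (f : SimpleGraph.Copy H G)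
    (hf : ∀ e ∈ H.edgeSet, ∀ e' ∈ H.edgeSet, ℓ' e < ℓ' e' → ℓ (e.map f) < ℓ (e'.map f)) :
    (ofLabel G ℓ hℓ).Contains (ofLabel H ℓ' hℓ') := by
  refine ⟨f, fun e e' => ⟨hf e.val e.2 e'.val e'.2, fun h => ?_⟩⟩
  change ℓ (e.val.map f) < ℓ (e'.val.map f) at h
  change ℓ' e.val < ℓ' e'.val
  rcases lt_trichotomy (ℓ' e.val) (ℓ' e'.val) with h' | h' | h'
  · exact h'
  · rw [hℓ' e.2 e'.2 h'] at h
    exact absurd h (lt_irrefl _)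
  · exact absurd h (lt_asymm (hf _ e'.2 _ e.2 h'))

theorem not_canAvoid_of_copy {V : Type u} {W : Type v} [Finite V] [Finite W] {G : SimpleGraph V}
    {H : SimpleGraph W} (f : SimpleGraph.Copy H G) {ℋ : Set EdgeOrderedGraph}
    (h : ¬ CanAvoid H ℋ) : ¬ CanAvoid G ℋ := by
  rw [not_canAvoid_iff] at h ⊢
  intro ℓ hℓ
  have hmap : ∀ e ∈ H.edgeSet, e.map f ∈ G.edgeSet :=
    fun e he => (f.toHom.mapEdgeSet ⟨e, he⟩).2
  have hℓ' : Set.InjOn (fun e => ℓ (e.map f)) H.edgeSet := fun e he e' he' hee' =>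
    Sym2.map.injective f.injective (hℓ (hmap e he) (hmap e' he') hee')
  obtain ⟨F, hF, hc⟩ := h _ hℓ'
  exact ⟨F, hF, Contains.trans (ofLabel_contains_ofLabel hℓ hℓ' f fun _ _ _ _ h => h) hc⟩

/-! ### Elementary bounds on the order chromatic number -/

theorem orderChromaticNumber_anti {ℋ ℋ' : Set EdgeOrderedGraph.{u}} (h : ℋ' ⊆ ℋ) :
    orderChromaticNumber ℋ ≤ orderChromaticNumber ℋ' := by
  refine sInf_le_sInf ?_
  rintro c ⟨V, hV, G, hG, rfl⟩
  exact ⟨V, hV, G, fun ⟨o, ho⟩ => hG ⟨o, fun H hH => ho H (h hH)⟩, rfl⟩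

theorem orderChromaticNumber_le {V : Type} [Finite V] {G : SimpleGraph V}
    {ℋ : Set EdgeOrderedGraph.{u}} (h : ¬ CanAvoid G ℋ) :
    orderChromaticNumber ℋ ≤ G.chromaticNumber :=
  sInf_le ⟨V, inferInstance, G, h, rfl⟩

theorem exists_not_canAvoid {ℋ : Set EdgeOrderedGraph.{u}} (h : orderChromaticNumber ℋ ≠ ⊤) :
    ∃ (V : Type) (_ : Finite V) (G : SimpleGraph V),
      ¬ CanAvoid G ℋ ∧ G.chromaticNumber = orderChromaticNumber ℋ := by
  refine csInf_mem (s := {c : ℕ∞ | ∃ (V : Type) (_ : Finite V) (G : SimpleGraph V),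
    ¬ CanAvoid G ℋ ∧ G.chromaticNumber = c}) ?_
  by_contra hne
  rw [Set.not_nonempty_iff_eq_empty] at hne
  exact h (by rw [orderChromaticNumber, hne, sInf_empty])

/-- A graph of chromatic number at most one has no edges, so it avoids all graphs with an edge. -/
theorem two_le_orderChromaticNumber {ℋ : Set EdgeOrderedGraph.{u}} (h : ∀ H ∈ ℋ, H.HasEdge) :
    2 ≤ orderChromaticNumber ℋ := by
  refine le_sInf ?_
  rintro c ⟨V, hV, G, hG, rfl⟩
  by_contra hlt
  have hle : G.chromaticNumber ≤ (1 : ℕ) := by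
    rw [not_le] at hlt
    exact Order.le_of_lt_add_one (by simpa [one_add_one_eq_two] using hlt)
  obtain ⟨C⟩ := SimpleGraph.chromaticNumber_le_iff_colorable.1 hle
  have hE : ∀ e, e ∉ G.edgeSet := by
    intro e
    induction e using Sym2.ind with
    | _ x y => exact fun hxy => C.valid hxy (Subsingleton.elim _ _)
  obtain ⟨H, hH, f, -⟩ := not_canAvoid_iff.1 hG (fun _ => 0) (fun e he => absurd he (hE e))
  obtain ⟨e, he⟩ := h H hH
  exact hE _ (f.toHom.mapEdgeSet ⟨e, he⟩).2

/-! ### Homogeneous edge-orders -/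

/-- A labelling of the pairs in `Fin k × Fin n`, thought of as `k` classes of `n` vertices each, is
homogeneous if the comparison of two labels depends only on the classes of the four vertices
involved and on the relative position of those of them that lie in the same class. -/
def Homogeneous {k n : ℕ} (ℓ : Sym2 (Fin k × Fin n) → ℕ) : Prop :=
  ∀ (c : Fin 4 → Fin k) (p q : Fin 4 → Fin n), (∀ s t, c s = c t → (p s < p t ↔ q s < q t)) →
    (ℓ s((c 0, p 0), (c 1, p 1)) < ℓ s((c 2, p 2), (c 3, p 3)) ↔
      ℓ s((c 0, q 0), (c 1, q 1)) < ℓ s((c 2, q 2), (c 3, q 3)))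

/-- Selecting `n` of the `N` vertices in each class. -/
def mapClasses {k n N : ℕ} (ψ : Fin k → Fin n → Fin N) (x : Fin k × Fin n) : Fin k × Fin N :=
  (x.1, ψ x.1 x.2)

/-- Ramsey's theorem for several classes. The vertices of the different classes are taken from
consecutive intervals of a single homogeneous set, so that the relative position of vertices of
different classes is fixed. -/
theorem exists_homogeneous (k n : ℕ) : ∃ N : ℕ, ∀ ℓ : Sym2 (Fin k × Fin N) → ℕ,
    ∃ ψ : Fin k → Fin n → Fin N, (∀ i, StrictMono (ψ i)) ∧
      Homogeneous fun e => ℓ (e.map (mapClasses ψ)) := by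
  obtain ⟨N, hN⟩ := exists_homogeneous_tuple 4 (k * n) ((Fin 4 → Fin k) → Prop)
  refine ⟨N, fun ℓ => ?_⟩
  obtain ⟨φ, hφ, hφN, hhom⟩ := hN fun p c => ∃ h : ∀ s, p s < N,
    ℓ s((c 0, ⟨p 0, h 0⟩), (c 1, ⟨p 1, h 1⟩)) < ℓ s((c 2, ⟨p 2, h 2⟩), (c 3, ⟨p 3, h 3⟩))
  have hpos : ∀ (i j : Fin k) (a b : Fin n), finProdFinEquiv (i, a) < finProdFinEquiv (j, b) ↔
      i < j ∨ i = j ∧ a < b := by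
    intro i j a b
    rw [Fin.lt_def, finProdFinEquiv_apply_val, finProdFinEquiv_apply_val]
    have hlt : ∀ (i j : Fin k) (a b : Fin n), i < j → a.val + n * i.val < b.val + n * j.val := by
      intro i j a b hij
      have : n * (i.val + 1) ≤ n * j.val := Nat.mul_le_mul_left _ hij
      have := a.isLt
      rw [Nat.mul_add] at *
      omega
    rcases lt_trichotomy i j with h | rfl | h
    · simp [h, hlt i j a b h]
    · simp
    · simp [h.not_gt, h.ne', (hlt j i b a h).not_gt]
  refine ⟨fun i a => ⟨φ (finProdFinEquiv (i, a)), hφN _⟩, fun i a b hab => ?_, ?_⟩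
  · exact hφ ((hpos i i a b).2 (Or.inr ⟨rfl, hab⟩))
  · intro c p q hpq
    have h := congrFun (hhom (fun s => finProdFinEquiv (c s, p s))
      (fun s => finProdFinEquiv (c s, q s)) fun s t => by
        rw [hpos, hpos]
        exact or_congr_right (and_congr_right (hpq s t))) c
    simpa [hφN, mapClasses] using h

/-- The pairs `a, a'` and `b, b'` are in the same relative position. -/
def SameCmp {n : ℕ} (a a' b b' : Fin n) : Prop := (a < a' ↔ b < b') ∧ (a' < a ↔ b' < b)

theorem SameCmp.rfl {n : ℕ} {a a' : Fin n} : SameCmp a a' a a' := ⟨Iff.rfl, Iff.rfl⟩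

theorem SameCmp.of_eq {n : ℕ} {a b : Fin n} : SameCmp a a b b := by simp [SameCmp]

theorem SameCmp.of_lt {n : ℕ} {a a' b b' : Fin n} (h : a < a') (h' : b < b') :
    SameCmp a a' b b' := by simp [SameCmp, h, h', h.not_gt, h'.not_gt]

theorem SameCmp.of_gt {n : ℕ} {a a' b b' : Fin n} (h : a' < a) (h' : b' < b) :
    SameCmp a a' b b' := by simp [SameCmp, h, h', h.not_gt, h'.not_gt]

section Homogeneous

variable {k n : ℕ} {ℓ : Sym2 (Fin k × Fin n) → ℕ}

theorem Homogeneous.pair (h : Homogeneous ℓ) {i j : Fin k} (hij : i ≠ j)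
    {a a' b b' x x' y y' : Fin n} (ha : SameCmp a a' x x') (hb : SameCmp b b' y y') :
    ℓ s((i, a), (j, b)) < ℓ s((i, a'), (j, b')) ↔
      ℓ s((i, x), (j, y)) < ℓ s((i, x'), (j, y')) :=
  h ![i, j, i, j] ![a, b, a', b'] ![x, y, x', y'] (by
    simp [Fin.forall_fin_succ, hij, hij.symm, ha.1, ha.2, hb.1, hb.2])

theorem Homogeneous.share (h : Homogeneous ℓ) {i j m : Fin k} (hij : i ≠ j) (him : i ≠ m)
    (hjm : j ≠ m) {a a' x x' : Fin n} (ha : SameCmp a a' x x') (b b' y y' : Fin n) :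
    ℓ s((i, a), (j, b)) < ℓ s((i, a'), (m, b')) ↔
      ℓ s((i, x), (j, y)) < ℓ s((i, x'), (m, y')) :=
  h ![i, j, i, m] ![a, b, a', b'] ![x, y, x', y'] (by
    simp [Fin.forall_fin_succ, hij, hij.symm, him, him.symm, hjm, hjm.symm, ha.1, ha.2])

end Homogeneous

/-! ### Few members of a family suffice -/

/-- If `C` prescribes the comparison of any two different edges, then the labelling `ℓ` follows `C`
when, after some automorphism of the graph, it orders the edges as prescribed. The edges are
given by a parametrization `edge`. -/
def Follows {V ι : Type*} (A : SimpleGraph V) (edge : ι → Sym2 V) (C : ι → ι → Prop)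
    (ℓ : Sym2 V → ℕ) : Prop :=
  ∃ σ : A ≃g A, ∀ x y, C x y → ℓ ((edge x).map σ) < ℓ ((edge y).map σ)

theorem contains_of_follows {V ι : Type*} [Finite V] {A : SimpleGraph V} {edge : ι → Sym2 V}
    (hedge : ∀ e ∈ A.edgeSet, ∃ x, edge x = e) {C : ι → ι → Prop}
    (hC : ∀ x y, C x y ∨ x = y ∨ C y x) {ℓ ℓ' : Sym2 V → ℕ} (hℓ : Set.InjOn ℓ A.edgeSet)
    (hℓ' : Set.InjOn ℓ' A.edgeSet) (h : Follows A edge C ℓ) (h' : Follows A edge C ℓ') :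
    (ofLabel A ℓ' hℓ').Contains (ofLabel A ℓ hℓ) := by
  obtain ⟨σ, hσ⟩ := h
  obtain ⟨τ, hτ⟩ := h'
  have hinv : ∀ e ∈ A.edgeSet, ∃ x, (edge x).map σ = e := by
    intro e he
    obtain ⟨x, hx⟩ := hedge (e.map σ.symm) (σ.symm.mapEdgeSet ⟨e, he⟩).2
    refine ⟨x, ?_⟩
    rw [hx, Sym2.map_map]
    exact (congrArg (Sym2.map · e) (funext fun v => σ.apply_symm_apply v)).trans
      (congrFun Sym2.map_id e)
  refine ofLabel_contains_ofLabel hℓ' hℓ (SimpleGraph.Iso.toCopy (σ.symm.trans τ))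
    fun e he e' he' hlt => ?_
  have hmap : ∀ x, ((edge x).map σ).map (SimpleGraph.Iso.toCopy (σ.symm.trans τ)) =
      (edge x).map τ := by
    intro x
    rw [Sym2.map_map]
    refine congrArg (Sym2.map · (edge x)) (funext fun v => ?_)
    change τ (σ.symm (σ v)) = τ v
    rw [σ.symm_apply_apply]
  obtain ⟨x, rfl⟩ := hinv e he
  obtain ⟨y, rfl⟩ := hinv e' he'
  rw [hmap, hmap]
  rcases hC x y with hxy | rfl | hxy
  · exact hτ x y hxy
  · exact absurd hlt (lt_irrefl _)
  · exact absurd hlt (lt_asymm (hσ y x hxy))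

section Selection

variable {k : ℕ} {A : ∀ n : ℕ, SimpleGraph (Fin k × Fin n)}

/-- In every edge-order of a sufficiently large graph of the sequence `A` one finds a homogeneous
copy of `A n`, provided that the graphs are preserved under selecting vertices in each class. -/
theorem exists_forall_contains_homogeneous
    (hA : ∀ n N (ψ : Fin k → Fin n → Fin N), (∀ i, StrictMono (ψ i)) →
      ∀ x y, (A n).Adj x y → (A N).Adj (mapClasses ψ x) (mapClasses ψ y)) (n : ℕ) :
    ∃ N, ∀ (ℓ : Sym2 (Fin k × Fin N) → ℕ) (h : Set.InjOn ℓ (A N).edgeSet),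
      ∃ (ℓ' : Sym2 (Fin k × Fin n) → ℕ) (h' : Set.InjOn ℓ' (A n).edgeSet),
        Homogeneous ℓ' ∧ (ofLabel (A N) ℓ h).Contains (ofLabel (A n) ℓ' h') := by
  obtain ⟨N, hN⟩ := exists_homogeneous k n
  refine ⟨N, fun ℓ hℓ => ?_⟩
  obtain ⟨ψ, hψ, hhom⟩ := hN ℓ
  have hinj : Function.Injective (mapClasses ψ) := by
    rintro ⟨i, a⟩ ⟨j, b⟩ h
    simp only [mapClasses, Prod.mk.injEq] at h
    obtain ⟨rfl, h⟩ := h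
    rw [(hψ i).injective h]
  let f : SimpleGraph.Copy (A n) (A N) := ⟨⟨mapClasses ψ, fun h => hA n N ψ hψ _ _ h⟩, hinj⟩
  have hℓ' : Set.InjOn (fun e => ℓ (e.map (mapClasses ψ))) (A n).edgeSet :=
    fun e he e' he' hee' => Sym2.map.injective hinj
      (hℓ (f.toHom.mapEdgeSet ⟨e, he⟩).2 (f.toHom.mapEdgeSet ⟨e', he'⟩).2 hee')
  exact ⟨_, hℓ', hhom, ofLabel_contains_ofLabel hℓ hℓ' f fun _ _ _ _ h => h⟩

/-- Suppose that the homogeneous edge-orders of `A n` are classified by finitely many codes, orders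
with a common code containing each other. If `A n` cannot avoid a family, then some `A N`
cannot avoid the subfamily that consists, for each code that occurs, of one graph contained in the
orders with that code. -/
theorem exists_subfamily
    (hA : ∀ n N (ψ : Fin k → Fin n → Fin N), (∀ i, StrictMono (ψ i)) →
      ∀ x y, (A n).Adj x y → (A N).Adj (mapClasses ψ x) (mapClasses ψ y)) {n : ℕ}
    {κ : Type*} [Finite κ] (T : κ → (Sym2 (Fin k × Fin n) → ℕ) → Prop)
    (hT : ∀ ℓ, Set.InjOn ℓ (A n).edgeSet → Homogeneous ℓ → ∃ c, T c ℓ)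
    (hTT : ∀ c ℓ ℓ' (hℓ : Set.InjOn ℓ (A n).edgeSet) (hℓ' : Set.InjOn ℓ' (A n).edgeSet),
      T c ℓ → T c ℓ' → (ofLabel (A n) ℓ' hℓ').Contains (ofLabel (A n) ℓ hℓ))
    {ℋ : Set EdgeOrderedGraph.{u}} (hℋ : ¬ CanAvoid (A n) ℋ) :
    ∃ ℋ' ⊆ ℋ, ℋ'.encard ≤ (Nat.card κ : ℕ∞) ∧ ∃ N, ¬ CanAvoid (A N) ℋ' := by
  rw [not_canAvoid_iff] at hℋ
  have hch : ∀ c : {c : κ // ∃ ℓ, Set.InjOn ℓ (A n).edgeSet ∧ T c ℓ}, ∃ H ∈ ℋ,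
      ∀ (ℓ : Sym2 (Fin k × Fin n) → ℕ) (h : Set.InjOn ℓ (A n).edgeSet), T c.1 ℓ →
        (ofLabel (A n) ℓ h).Contains H := by
    rintro ⟨c, ℓ, hℓ, hc⟩
    obtain ⟨H, hH, hcon⟩ := hℋ ℓ hℓ
    exact ⟨H, hH, fun ℓ' hℓ' hc' => Contains.trans (hTT c ℓ ℓ' hℓ hℓ' hc hc') hcon⟩
  choose H hH hcon using hch
  refine ⟨Set.range H, Set.range_subset_iff.2 hH, ?_, ?_⟩
  · rw [← Set.image_univ]
    refine (Set.encard_image_le _ _).trans ?_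
    rw [Set.encard_univ, ENat.card_eq_coe_natCard]
    exact_mod_cast Finite.card_subtype_le _
  · obtain ⟨N, hN⟩ := exists_forall_contains_homogeneous hA n
    refine ⟨N, not_canAvoid_iff.2 fun ℓ hℓ => ?_⟩
    obtain ⟨ℓ', hℓ', hhom, hc⟩ := hN ℓ hℓ
    obtain ⟨c, hT'⟩ := hT ℓ' hℓ' hhom
    exact ⟨_, ⟨⟨c, ℓ', hℓ', hT'⟩, rfl⟩, Contains.trans hc (hcon _ ℓ' hℓ' hT')⟩

end Selection

/-! ### Directions and the two-class case -/

/-- The identity of `Fin n` or its reversal. It serves both to compare vertices of a class in one of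
the two directions and to reverse the numbering of a class. -/
def orient {n : ℕ} (d : Bool) (a : Fin n) : Fin n := if d then a else a.rev

theorem orient_orient {n : ℕ} (d : Bool) (a : Fin n) : orient d (orient d a) = a := by
  cases d <;> simp [orient]

theorem orient_inj {n : ℕ} {d : Bool} {a b : Fin n} : orient d a = orient d b ↔ a = b := by
  cases d <;> simp [orient]

theorem SameCmp.of_orient {n : ℕ} {d : Bool} {a a' b b' : Fin n} (h : orient d a < orient d a')
    (h' : orient d b < orient d b') : SameCmp a a' b b' := by
  cases d
  · exact SameCmp.of_gt (Fin.rev_lt_rev.1 h) (Fin.rev_lt_rev.1 h')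
  · exact SameCmp.of_lt h h'

theorem SameCmp.swap {n : ℕ} {a a' b b' : Fin n} (h : SameCmp a a' b b') : SameCmp a' a b' b :=
  ⟨h.2, h.1⟩

theorem orient_trichotomy {n : ℕ} (d : Bool) (a b : Fin n) :
    orient d a < orient d b ∨ a = b ∨ orient d b < orient d a := by
  rw [← orient_inj (d := d)]
  exact lt_trichotomy _ _

/-- The complete `k`-partite graph with `n` vertices in each class. -/
def multipartite (k n : ℕ) : SimpleGraph (Fin k × Fin n) := (⊤ : SimpleGraph (Fin k)).comap Prod.fst

theorem multipartite_adj {k n : ℕ} {x y : Fin k × Fin n} :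
    (multipartite k n).Adj x y ↔ x.1 ≠ y.1 := Iff.rfl

section Blocks

variable {k n : ℕ} (ℓ : Sym2 (Fin k × Fin n) → ℕ)

/-- With the vertex in class `j` fixed, the labels of the edges between classes `i` and `j` increase
in the direction `d` of class `i`. -/
def FixedDir (i j : Fin k) (d : Bool) : Prop :=
  ∀ a a' b, orient d a < orient d a' → ℓ s((i, a), (j, b)) < ℓ s((i, a'), (j, b))

/-- The labels of the edges between classes `i` and `j` are primarily ordered by the vertex in class
`i`, in the direction `d`. -/
def Primary (i j : Fin k) (d : Bool) : Prop :=
  ∀ a a' b b', orient d a < orient d a' → ℓ s((i, a), (j, b)) < ℓ s((i, a'), (j, b'))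

variable {ℓ}

theorem Primary.fixedDir {i j : Fin k} {d : Bool} (h : Primary ℓ i j d) : FixedDir ℓ i j d :=
  fun a a' b => h a a' b b

theorem lt_of_not_lt (hℓ : Set.InjOn ℓ (multipartite k n).edgeSet) {i j i' j' : Fin k}
    (hij : i ≠ j) (hij' : i' ≠ j') {a b a' b' : Fin n}
    (hne : s((i, a), (j, b)) ≠ s((i', a'), (j', b')))
    (h : ¬ ℓ s((i, a), (j, b)) < ℓ s((i', a'), (j', b'))) :
    ℓ s((i', a'), (j', b')) < ℓ s((i, a), (j, b)) :=
  lt_of_le_of_ne (not_lt.1 h) fun heq => hne (hℓ hij hij' heq.symm)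

theorem exists_fixedDir (hℓ : Set.InjOn ℓ (multipartite k n).edgeSet) (hom : Homogeneous ℓ)
    {i j : Fin k} (hij : i ≠ j) : ∃ d, FixedDir ℓ i j d := by
  by_cases h : FixedDir ℓ i j true
  · exact ⟨true, h⟩
  · simp only [FixedDir, not_forall] at h
    obtain ⟨a, a', b, hlt, h⟩ := h
    have h' := lt_of_not_lt hℓ hij hij (by simp [hij, (show a < a' from hlt).ne]) h
    refine ⟨false, fun x x' y hx => ?_⟩
    exact (hom.pair hij (SameCmp.of_gt hlt (Fin.rev_lt_rev.1 hx)) SameCmp.of_eq).1 h'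

/-- Between two classes, a homogeneous order is lexicographic: let `a, a'` and `b, b'` increase in
the directions of the two classes; then the class that decides the comparison of `a b'` and
`a' b` is the primary one. -/
theorem primary_or_primary (hℓ : Set.InjOn ℓ (multipartite k n).edgeSet) (hom : Homogeneous ℓ)
    {i j : Fin k} (hij : i ≠ j) {d d' : Bool} (hd : FixedDir ℓ i j d) (hd' : FixedDir ℓ j i d') :
    Primary ℓ i j d ∨ Primary ℓ j i d' := by
  have hd'' : ∀ a b b', orient d' b < orient d' b' →
      ℓ s((i, a), (j, b)) < ℓ s((i, a), (j, b')) := by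
    intro a b b' h
    rw [Sym2.eq_swap, Sym2.eq_swap (a := (i, a))]
    exact hd' b b' a h
  by_cases h : Primary ℓ i j d
  · exact Or.inl h
  simp only [Primary, not_forall] at h
  obtain ⟨a, a', b, b', ha, h⟩ := h
  have hb : orient d' b' < orient d' b := by
    rcases orient_trichotomy d' b b' with hb | rfl | hb
    · exact absurd ((hd a a' b ha).trans (hd'' a' b b' hb)) h
    · exact absurd (hd a a' b ha) h
    · exact hb
  have hne : a ≠ a' := fun h => by rw [h] at ha; exact lt_irrefl _ ha
  have h' := lt_of_not_lt hℓ hij hij (by simp [hij, hne]) h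
  refine Or.inr fun y y' x x' hy => ?_
  rw [Sym2.eq_swap, Sym2.eq_swap (a := (j, y'))]
  rcases orient_trichotomy d x x' with hx | rfl | hx
  · exact (hd x x' y hx).trans (hd'' x' y y' hy)
  · exact hd'' x y y' hy
  · exact (hom.pair hij (SameCmp.of_orient ha hx).swap (SameCmp.of_orient hb hy)).1 h'

theorem not_primary_and_primary {i j : Fin k} {d d' : Bool} {x y : Fin n} (hxy : x < y)
    (h : Primary ℓ i j d) (h' : Primary ℓ j i d') : False := by
  have h1 := h (orient d x) (orient d y) (orient d' y) (orient d' x)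
    (by rwa [orient_orient, orient_orient])
  have h2 := h' (orient d' x) (orient d' y) (orient d y) (orient d x)
    (by rwa [orient_orient, orient_orient])
  rw [Sym2.eq_swap, Sym2.eq_swap (a := (j, orient d' y))] at h2
  exact lt_asymm h1 h2

end Blocks

/-! ### The canonical order of the complete bipartite graph -/

theorem canonicalLabel_inl_inr_lt {n : ℕ} {i j i' j' : Fin n} :
    canonicalLabel n s(.inl i, .inr j) < canonicalLabel n s(.inl i', .inr j') ↔
      i < i' ∨ i = i' ∧ j < j' := by
  change n * (i.val + 1) + (j.val + 1) < n * (i'.val + 1) + (j'.val + 1) ↔ _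
  have hlt : ∀ i j i' j' : Fin n, i < i' →
      n * (i.val + 1) + (j.val + 1) < n * (i'.val + 1) + (j'.val + 1) := by
    intro i j i' j' h
    have h1 : n * (i.val + 1) ≤ n * i'.val := Nat.mul_le_mul_left _ h
    have h2 : n * (i'.val + 1) = n * i'.val + n := by ring
    have := j.isLt
    omega
  rcases lt_trichotomy i i' with h | rfl | h
  · simp [h, hlt i j i' j' h]
  · simp
  · simp [h.not_gt, h.ne', (hlt i' j' i j h).not_gt]

theorem canonicalLabel_injOn (n : ℕ) :
    Set.InjOn (canonicalLabel n) (completeBipartiteGraph (Fin n) (Fin n)).edgeSet :=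
  fun e he e' he' h =>
    congrArg Subtype.val (canonicalLabel_injective n (a₁ := ⟨e, he⟩) (a₂ := ⟨e', he'⟩) h)

theorem canonicalBipartite_eq (n : ℕ) : canonicalBipartite n =
    ofLabel (completeBipartiteGraph (Fin n) (Fin n)) (canonicalLabel n) (canonicalLabel_injOn n) :=
  rfl

theorem exists_eq_inl_inr {α β : Type*} {e : Sym2 (α ⊕ β)}
    (he : e ∈ (completeBipartiteGraph α β).edgeSet) : ∃ a b, e = s(.inl a, .inr b) := by
  induction e using Sym2.ind with
  | _ x y =>
    rcases x with a | b <;> rcases y with c | d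
    · simp at he
    · exact ⟨a, d, rfl⟩
    · exact ⟨c, b, Sym2.eq_swap⟩
    · simp at he

theorem contains_canonicalBipartite_of_primary {n : ℕ} {ℓ : Sym2 (Fin 2 × Fin n) → ℕ}
    (hℓ : Set.InjOn ℓ (multipartite 2 n).edgeSet) {i j : Fin 2} (hij : i ≠ j) {d d' : Bool}
    (hP : Primary ℓ i j d) (hd' : FixedDir ℓ j i d') :
    (ofLabel (multipartite 2 n) ℓ hℓ).Contains (canonicalBipartite n) := by
  let f : Fin n ⊕ Fin n → Fin 2 × Fin n :=
    Sum.elim (fun a => (i, orient d a)) (fun b => (j, orient d' b))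
  have hf : Function.Injective f := by
    rintro (a | a) (b | b) h
    · simpa [f, orient_inj] using h
    · exact absurd (congrArg Prod.fst h) hij
    · exact absurd (congrArg Prod.fst h) hij.symm
    · simpa [f, orient_inj] using h
  let F : completeBipartiteGraph (Fin n) (Fin n) →g multipartite 2 n := ⟨f, by
    rintro (a | a) (b | b) h
    · simp at h
    · exact hij
    · exact hij.symm
    · simp at h⟩
  rw [canonicalBipartite_eq]
  refine ofLabel_contains_ofLabel hℓ (canonicalLabel_injOn n) ⟨F, hf⟩ fun e he e' he' hlt => ?_
  obtain ⟨a, b, rfl⟩ := exists_eq_inl_inr he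
  obtain ⟨a', b', rfl⟩ := exists_eq_inl_inr he'
  change ℓ s((i, orient d a), (j, orient d' b)) < ℓ s((i, orient d a'), (j, orient d' b'))
  rcases canonicalLabel_inl_inr_lt.1 hlt with h | ⟨rfl, h⟩
  · exact hP _ _ _ _ (by rwa [orient_orient, orient_orient])
  · rw [Sym2.eq_swap, Sym2.eq_swap (a := (i, orient d a))]
    exact hd' _ _ _ (by rwa [orient_orient, orient_orient])

theorem contains_canonicalBipartite {n : ℕ} {ℓ : Sym2 (Fin 2 × Fin n) → ℕ}
    (hℓ : Set.InjOn ℓ (multipartite 2 n).edgeSet) (hom : Homogeneous ℓ) :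
    (ofLabel (multipartite 2 n) ℓ hℓ).Contains (canonicalBipartite n) := by
  obtain ⟨d, hd⟩ := exists_fixedDir hℓ hom (zero_ne_one' (Fin 2))
  obtain ⟨d', hd'⟩ := exists_fixedDir hℓ hom (zero_ne_one' (Fin 2)).symm
  rcases primary_or_primary hℓ hom (zero_ne_one' (Fin 2)) hd hd' with h | h
  · exact contains_canonicalBipartite_of_primary hℓ (zero_ne_one' (Fin 2)) h hd'
  · exact contains_canonicalBipartite_of_primary hℓ (zero_ne_one' (Fin 2)).symm h hd

/-- In a finite linear order, a set of at most `n` elements can be numbered increasingly by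
`Fin n`. -/
theorem exists_strictMonoOn_fin {α : Type*} [LinearOrder α] (S : Finset α) {n : ℕ}
    (h : S.card ≤ n) : ∃ ρ : S → Fin n, StrictMono ρ :=
  ⟨fun x => Fin.castLE h ((S.orderIsoOfFin rfl).symm x), fun _ _ hxy =>
    Fin.strictMono_castLE h ((S.orderIsoOfFin rfl).symm.strictMono hxy)⟩

/-- A copy of `G` in the canonical order uses at most `|V(G)|` vertices on each side, and these can
be renumbered increasingly. -/
theorem canonicalBipartite_contains_of_contains {G : EdgeOrderedGraph.{u}} {m n : ℕ}
    (h : (canonicalBipartite m).Contains G) (hn : Nat.card G.V ≤ n) :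
    (canonicalBipartite n).Contains G := by
  classical
  obtain ⟨f, hf⟩ := h
  have := G.finite
  have := Fintype.ofFinite G.V
  let g : G.V → Fin m ⊕ Fin m := fun v => f v
  have hg : Function.Injective g := f.injective
  have hcard : ∀ {β : Type} [DecidableEq β] (s : β → Fin m ⊕ Fin m), Function.Injective s →
      ∀ S : Finset β, (∀ x ∈ S, ∃ v, g v = s x) → S.card ≤ n := by
    intro β _ s hs S hS
    refine le_trans ?_ (Nat.card_eq_fintype_card.symm.le.trans hn)
    rw [← Finset.card_image_of_injective S hs, ← Finset.card_univ]
    refine (Finset.card_le_card ?_).trans (Finset.card_image_le (s := Finset.univ) (f := g))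
    intro y hy
    obtain ⟨x, hx, rfl⟩ := Finset.mem_image.1 hy
    obtain ⟨v, hv⟩ := hS x hx
    exact Finset.mem_image.2 ⟨v, Finset.mem_univ _, hv⟩
  let Sl : Finset (Fin m) := Finset.univ.filter fun i => ∃ v, g v = .inl i
  let Sr : Finset (Fin m) := Finset.univ.filter fun i => ∃ v, g v = .inr i
  obtain ⟨ρl, hρl⟩ := exists_strictMonoOn_fin Sl
    (hcard Sum.inl Sum.inl_injective Sl fun x hx => (Finset.mem_filter.1 hx).2)
  obtain ⟨ρr, hρr⟩ := exists_strictMonoOn_fin Sr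
    (hcard Sum.inr Sum.inr_injective Sr fun x hx => (Finset.mem_filter.1 hx).2)
  have hl : ∀ {v i}, g v = .inl i → i ∈ Sl := fun {v i} h =>
    Finset.mem_filter.2 ⟨Finset.mem_univ _, v, h⟩
  have hr : ∀ {v i}, g v = .inr i → i ∈ Sr := fun {v i} h =>
    Finset.mem_filter.2 ⟨Finset.mem_univ _, v, h⟩
  have hex : ∀ v, ∃ y : Fin n ⊕ Fin n, (∀ i (h : g v = .inl i), y = .inl (ρl ⟨i, hl h⟩)) ∧
      ∀ i (h : g v = .inr i), y = .inr (ρr ⟨i, hr h⟩) := by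
    intro v
    obtain ⟨i, hv⟩ | ⟨i, hv⟩ : (∃ i, g v = .inl i) ∨ ∃ i, g v = .inr i := by
      rcases g v with i | i <;> simp
    · refine ⟨.inl (ρl ⟨i, hl hv⟩), fun j h => ?_, fun j h => ?_⟩
      · obtain rfl := Sum.inl.inj (h.symm.trans hv); rfl
      · cases h.symm.trans hv
    · refine ⟨.inr (ρr ⟨i, hr hv⟩), fun j h => ?_, fun j h => ?_⟩
      · cases h.symm.trans hv
      · obtain rfl := Sum.inr.inj (h.symm.trans hv); rfl
  choose t htl htr using hex
  have hadj : ∀ {v w}, G.graph.Adj v w → (∃ i j, g v = .inl i ∧ g w = .inr j) ∨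
      ∃ i j, g v = .inr i ∧ g w = .inl j := by
    intro v w h
    have h' : (completeBipartiteGraph (Fin m) (Fin m)).Adj (g v) (g w) := f.toHom.map_adj h
    rcases hv : g v with i | i <;> rcases hw : g w with j | j <;> rw [hv, hw] at h'
    · simp at h'
    · exact Or.inl ⟨i, j, rfl, rfl⟩
    · exact Or.inr ⟨i, j, rfl, rfl⟩
    · simp at h'
  have ht : Function.Injective t := by
    intro v w h
    apply hg
    rcases hv : g v with i | i <;> rcases hw : g w with j | j
    · rw [htl v i hv, htl w j hw, Sum.inl.injEq, hρl.injective.eq_iff, Subtype.mk.injEq] at h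
      rw [h]
    · rw [htl v i hv, htr w j hw] at h; cases h
    · rw [htr v i hv, htl w j hw] at h; cases h
    · rw [htr v i hv, htr w j hw, Sum.inr.injEq, hρr.injective.eq_iff, Subtype.mk.injEq] at h
      rw [h]
  let T : G.graph →g completeBipartiteGraph (Fin n) (Fin n) := ⟨t, by
    intro v w h
    rcases hadj h with ⟨i, j, hv, hw⟩ | ⟨i, j, hv, hw⟩
    · rw [htl v i hv, htr w j hw]; simp
    · rw [htr v i hv, htl w j hw]; simp⟩
  have hedge : ∀ e ∈ G.graph.edgeSet, ∃ i j, ∃ (hi : i ∈ Sl) (hj : j ∈ Sr),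
      e.map g = s(.inl i, .inr j) ∧ e.map t = s(.inl (ρl ⟨i, hi⟩), .inr (ρr ⟨j, hj⟩)) := by
    intro e he
    induction e using Sym2.ind with
    | _ v w =>
      rcases hadj he with ⟨i, j, hv, hw⟩ | ⟨j, i, hv, hw⟩
      · refine ⟨i, j, hl hv, hr hw, ?_, ?_⟩
        · rw [Sym2.map_mk, hv, hw]
        · rw [Sym2.map_mk, htl v i hv, htr w j hw]
      · refine ⟨i, j, hl hw, hr hv, ?_, ?_⟩
        · rw [Sym2.map_mk, hv, hw, Sym2.eq_swap]
        · rw [Sym2.map_mk, htl w i hw, htr v j hv, Sym2.eq_swap]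
  refine ⟨⟨T, ht⟩, fun e e' => (hf e e').trans ?_⟩
  change canonicalLabel m (e.val.map g) < canonicalLabel m (e'.val.map g) ↔
    canonicalLabel n (e.val.map t) < canonicalLabel n (e'.val.map t)
  obtain ⟨i, j, hi, hj, h1, h2⟩ := hedge e.val e.2
  obtain ⟨i', j', hi', hj', h1', h2'⟩ := hedge e'.val e'.2
  rw [h1, h2, h1', h2', canonicalLabel_inl_inr_lt, canonicalLabel_inl_inr_lt, hρl.lt_iff_lt,
    hρr.lt_iff_lt, hρl.injective.eq_iff]
  simp only [Subtype.mk_lt_mk, Subtype.mk.injEq]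

/-! ### Relabelling classes and vertices -/

/-- Permuting the classes, and reversing the numbering within some of them. -/
def relabel {k n : ℕ} (π : Equiv.Perm (Fin k)) (d : Fin k → Bool) :
    Fin k × Fin n ≃ Fin k × Fin n where
  toFun x := (π x.1, orient (d x.1) x.2)
  invFun x := (π.symm x.1, orient (d (π.symm x.1)) x.2)
  left_inv x := by simp [orient_orient]
  right_inv x := by simp [orient_orient]

theorem orient_lt_orient_iff_of_iff {n : ℕ} {d : Bool} {a b a' b' : Fin n} (h : a < b ↔ a' < b')
    (h' : b < a ↔ b' < a') : orient d a < orient d b ↔ orient d a' < orient d b' := by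
  cases d <;> simp [orient, h, h']

theorem Homogeneous.relabel {k n : ℕ} {ℓ : Sym2 (Fin k × Fin n) → ℕ} (h : Homogeneous ℓ)
    (π : Equiv.Perm (Fin k)) (d : Fin k → Bool) :
    Homogeneous fun e => ℓ (e.map (relabel π d)) := by
  intro c p q hpq
  refine h (fun s => π (c s)) (fun s => orient (d (c s)) (p s)) (fun s => orient (d (c s)) (q s))
    fun s t hst => ?_
  have hst' : c s = c t := π.injective hst
  simp only [hst']
  exact orient_lt_orient_iff_of_iff (hpq s t hst') (hpq t s hst'.symm)

theorem injOn_comp_iso {V : Type*} {A : SimpleGraph V} {ℓ : Sym2 V → ℕ}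
    (h : Set.InjOn ℓ A.edgeSet) (σ : A ≃g A) : Set.InjOn (fun e => ℓ (e.map σ)) A.edgeSet :=
  fun e he e' he' hee' => Sym2.map.injective σ.injective
    (h (σ.mapEdgeSet ⟨e, he⟩).2 (σ.mapEdgeSet ⟨e', he'⟩).2 hee')

/-! ### Homogeneous orders of complete graphs -/

section Complete

variable {n : ℕ} {ℓ : Sym2 (Fin 1 × Fin n) → ℕ}

/-- For two different edges spanned by `m` vertices, which of them is the smaller one does not
depend on the choice of the `m` vertices. -/
theorem Homogeneous.lt_or_lt (hℓ : Set.InjOn ℓ (⊤ : SimpleGraph (Fin 1 × Fin n)).edgeSet)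
    (hom : Homogeneous ℓ) {m : ℕ} {i j i' j' : Fin m} (hij : i ≠ j) (hij' : i' ≠ j')
    (hne : s(i, j) ≠ s(i', j')) :
    (∀ x : Fin m → Fin n, StrictMono x →
      ℓ s((0, x i), (0, x j)) < ℓ s((0, x i'), (0, x j'))) ∨
    (∀ x : Fin m → Fin n, StrictMono x →
      ℓ s((0, x i'), (0, x j')) < ℓ s((0, x i), (0, x j))) := by
  by_cases h : ∀ x : Fin m → Fin n, StrictMono x →
      ℓ s((0, x i), (0, x j)) < ℓ s((0, x i'), (0, x j'))
  · exact Or.inl h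
  right
  push Not at h
  obtain ⟨y, hy, h⟩ := h
  intro x hx
  refine lt_of_le_of_ne (not_lt.1 fun h' => ?_) fun heq => ?_
  · refine absurd ((hom (fun _ => 0) (x ∘ ![i, j, i', j']) (y ∘ ![i, j, i', j']) fun s t _ => ?_).1
      h') (not_lt.2 h)
    exact hx.lt_iff_lt.trans hy.lt_iff_lt.symm
  · have hinj : Function.Injective fun a => ((0 : Fin 1), x a) :=
      fun a b hab => hx.injective (congrArg Prod.snd hab)
    have hadj : ∀ {a b}, a ≠ b →
        s(((0 : Fin 1), x a), (0, x b)) ∈ (⊤ : SimpleGraph (Fin 1 × Fin n)).edgeSet :=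
      fun h => (SimpleGraph.top_adj _ _).2 (hinj.ne h)
    exact hne (Sym2.map.injective hinj (a₁ := s(i', j')) (a₂ := s(i, j))
      (hℓ (hadj hij') (hadj hij) heq)).symm

theorem strictMono_vec₃ {a b c : Fin n} (hab : a < b) (hbc : b < c) :
    StrictMono ![a, b, c] := by
  simp [Fin.strictMono_iff_lt_succ, Fin.forall_fin_succ, hab, hbc]

theorem strictMono_vec₄ {a b c d : Fin n} (hab : a < b) (hbc : b < c) (hcd : c < d) :
    StrictMono ![a, b, c, d] := by
  simp [Fin.strictMono_iff_lt_succ, Fin.forall_fin_succ, hab, hbc, hcd]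

/-- The four canonical orders of the edges `ab` with `a < b`: lexicographic, with the smaller end
vertex first if `c.1` holds and the larger one first otherwise, the second criterion being taken
in direction `c.2`. -/
def CompleteLt (c : Bool × Bool) (e f : {p : Fin n × Fin n // p.1 < p.2}) : Prop :=
  if c.1 then e.1.1 < f.1.1 ∨ e.1.1 = f.1.1 ∧ orient c.2 e.1.2 < orient c.2 f.1.2
  else e.1.2 < f.1.2 ∨ e.1.2 = f.1.2 ∧ orient c.2 e.1.1 < orient c.2 f.1.1

theorem completeLt_trichotomy (c : Bool × Bool) (e f : {p : Fin n × Fin n // p.1 < p.2}) :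
    CompleteLt c e f ∨ e = f ∨ CompleteLt c f e := by
  obtain ⟨c₁, c₂⟩ := c
  obtain ⟨⟨a, b⟩, h⟩ := e
  obtain ⟨⟨a', b'⟩, h'⟩ := f
  simp only [CompleteLt, Subtype.mk.injEq, Prod.mk.injEq]
  cases c₁
  · rcases lt_trichotomy b b' with hb | rfl | hb
    · simp [hb]
    · rcases orient_trichotomy c₂ a a' with ha | rfl | ha <;> simp [*]
    · simp [hb]
  · rcases lt_trichotomy a a' with ha | rfl | ha
    · simp [ha]
    · rcases orient_trichotomy c₂ b b' with hb | rfl | hb <;> simp [*]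
    · simp [ha]

/-- The edge `ab` of the complete graph. -/
def completeEdge (e : {p : Fin n × Fin n // p.1 < p.2}) : Sym2 (Fin 1 × Fin n) :=
  s((0, e.1.1), (0, e.1.2))

theorem exists_completeEdge_eq :
    ∀ e ∈ (⊤ : SimpleGraph (Fin 1 × Fin n)).edgeSet, ∃ x, completeEdge x = e := by
  intro e he
  induction e using Sym2.ind with
  | _ x y =>
    obtain ⟨i, a⟩ := x
    obtain ⟨j, b⟩ := y
    obtain rfl := Subsingleton.elim i 0
    obtain rfl := Subsingleton.elim j 0
    rcases lt_trichotomy a b with h | rfl | h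
    · exact ⟨⟨(a, b), h⟩, rfl⟩
    · exact absurd rfl he
    · exact ⟨⟨(b, a), h⟩, Sym2.eq_swap⟩

/-- If `ab` precedes `bc` for `a < b < c`, then the order is one of the four canonical ones. -/
theorem exists_completeLt_of_consecutive
    (hℓ : Set.InjOn ℓ (⊤ : SimpleGraph (Fin 1 × Fin n)).edgeSet) (hom : Homogeneous ℓ)
    (hn : 5 ≤ n)
    (hcons : ∀ a b c : Fin n, a < b → b < c → ℓ s((0, a), (0, b)) < ℓ s((0, b), (0, c))) :
    ∃ c, ∀ x y, CompleteLt c x y → ℓ (completeEdge x) < ℓ (completeEdge y) := by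
  set L : Fin n → Fin n → ℕ := fun a b => ℓ s((0, a), (0, b)) with hL
  change ∀ a b c, a < b → b < c → L a b < L b c at hcons
  have hdisj : ∀ a b c d, a < b → b < c → c < d → L a b < L c d :=
    fun a b c d h h' h'' => (hcons a b c h h').trans (hcons b c d h' h'')
  -- crossing pairs: the opposite would give `35 < 24 < 13` for vertices `1, …, 5`
  have hcross : ∀ a b c d, a < b → b < c → c < d → L a c < L b d := by
    rcases Homogeneous.lt_or_lt (m := 4) (i := 0) (j := 2) (i' := 1) (j' := 3) hℓ hom
      (by decide) (by decide) (by decide) with h | h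
    · exact fun a b c d h1 h2 h3 => h _ (strictMono_vec₄ h1 h2 h3)
    · exfalso
      let x : Fin 5 → Fin n := Fin.castLE hn
      have hx : StrictMono x := Fin.strictMono_castLE hn
      have h1 : L (x 1) (x 3) < L (x 0) (x 2) :=
        h _ (strictMono_vec₄ (hx (by decide : (0 : Fin 5) < 1))
        (hx (by decide : (1 : Fin 5) < 2)) (hx (by decide : (2 : Fin 5) < 3)))
      have h2 : L (x 2) (x 4) < L (x 1) (x 3) :=
        h _ (strictMono_vec₄ (hx (by decide : (1 : Fin 5) < 2))
        (hx (by decide : (2 : Fin 5) < 3)) (hx (by decide : (3 : Fin 5) < 4)))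
      have h3 := hcons (x 0) (x 2) (x 4) (hx (by decide)) (hx (by decide))
      exact lt_asymm h3 (h2.trans h1)
  have hfst : (∀ a b c, a < b → b < c → L a b < L a c) ∨
      (∀ a b c, a < b → b < c → L a c < L a b) := by
    rcases Homogeneous.lt_or_lt (m := 3) (i := 0) (j := 1) (i' := 0) (j' := 2) hℓ hom
      (by decide) (by decide) (by decide) with h | h
    · exact Or.inl fun a b c h1 h2 => h _ (strictMono_vec₃ h1 h2)
    · exact Or.inr fun a b c h1 h2 => h _ (strictMono_vec₃ h1 h2)
  have hsnd : (∀ a b c, a < b → b < c → L a c < L b c) ∨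
      (∀ a b c, a < b → b < c → L b c < L a c) := by
    rcases Homogeneous.lt_or_lt (m := 3) (i := 0) (j := 2) (i' := 1) (j' := 2) hℓ hom
      (by decide) (by decide) (by decide) with h | h
    · exact Or.inl fun a b c h1 h2 => h _ (strictMono_vec₃ h1 h2)
    · exact Or.inr fun a b c h1 h2 => h _ (strictMono_vec₃ h1 h2)
  have hnest : (∀ a b c d, a < b → b < c → c < d → L a d < L b c) ∨
      (∀ a b c d, a < b → b < c → c < d → L b c < L a d) := by
    rcases Homogeneous.lt_or_lt (m := 4) (i := 0) (j := 3) (i' := 1) (j' := 2) hℓ hom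
      (by decide) (by decide) (by decide) with h | h
    · exact Or.inl fun a b c d h1 h2 h3 => h _ (strictMono_vec₄ h1 h2 h3)
    · exact Or.inr fun a b c d h1 h2 h3 => h _ (strictMono_vec₄ h1 h2 h3)
  -- edges `ab` and `cd` with `a < c` and `b < d` compare in the same way in all four cases
  have hmono : ∀ a b c d, a < b → c < d → a < c → b < d → L a b < L c d := by
    intro a b c d hab hcd hac hbd
    rcases lt_trichotomy b c with h | rfl | h
    · exact hdisj a b c d hab h hcd
    · exact hcons a b d hab hbd
    · exact hcross a c b d hac h hbd
  suffices ∃ c, ∀ x y, CompleteLt c x y → L x.1.1 x.1.2 < L y.1.1 y.1.2 from this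
  rcases hfst with hfst | hfst <;> rcases hsnd with hsnd | hsnd
  · rcases hnest with hnest | hnest
    · refine ⟨(true, true), ?_⟩
      rintro ⟨⟨a, b⟩, hab⟩ ⟨⟨c, d⟩, hcd⟩ (hac | ⟨rfl, hbd⟩)
      · rcases lt_trichotomy b d with hbd | rfl | hbd
        · exact hmono a b c d hab hcd hac hbd
        · exact hsnd a c b hac hcd
        · exact hnest a c d b hac hcd hbd
      · exact hfst a b d hab hbd
    · refine ⟨(false, true), ?_⟩
      rintro ⟨⟨a, b⟩, hab⟩ ⟨⟨c, d⟩, hcd⟩ (hbd | ⟨rfl, hac⟩)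
      · rcases lt_trichotomy a c with hac | rfl | hac
        · exact hmono a b c d hab hcd hac hbd
        · exact hfst a b d hab hbd
        · exact hnest c a b d hac hab hbd
      · exact hsnd a c b hac hcd
  · refine ⟨(false, false), ?_⟩
    rintro ⟨⟨a, b⟩, hab⟩ ⟨⟨c, d⟩, hcd⟩ (hbd | ⟨rfl, hac⟩)
    · rcases lt_trichotomy a c with hac | rfl | hac
      · exact hmono a b c d hab hcd hac hbd
      · exact hfst a b d hab hbd
      · exact (hsnd c a b hac hab).trans (hfst c b d (hac.trans hab) hbd)
    · exact hsnd c a b (Fin.rev_lt_rev.1 hac) hab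
  · refine ⟨(true, false), ?_⟩
    rintro ⟨⟨a, b⟩, hab⟩ ⟨⟨c, d⟩, hcd⟩ (hac | ⟨rfl, hbd⟩)
    · rcases lt_trichotomy b d with hbd | rfl | hbd
      · exact hmono a b c d hab hcd hac hbd
      · exact hsnd a c b hac hcd
      · exact (hfst a d b (hac.trans hcd) hbd).trans (hsnd a c d hac hcd)
    · exact hfst a d b hcd (Fin.rev_lt_rev.1 hbd)
  · -- here `bc < ac < ab` for `a < b < c`
    exfalso
    let x : Fin 5 → Fin n := Fin.castLE hn
    have hx : StrictMono x := Fin.strictMono_castLE hn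
    have h01 : x 0 < x 1 := hx (by decide)
    have h12 : x 1 < x 2 := hx (by decide)
    exact lt_asymm (hcons _ _ _ h01 h12) ((hsnd _ _ _ h01 h12).trans (hfst _ _ _ h01 h12))

/-- The homogeneous orders of a complete graph are the four canonical ones, possibly after
reversing the numbering of the vertices. -/
theorem exists_follows_completeLt
    (hℓ : Set.InjOn ℓ (⊤ : SimpleGraph (Fin 1 × Fin n)).edgeSet) (hom : Homogeneous ℓ)
    (hn : 5 ≤ n) :
    ∃ c, Follows (⊤ : SimpleGraph (Fin 1 × Fin n)) completeEdge (CompleteLt c) ℓ := by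
  let σ : Bool → ((⊤ : SimpleGraph (Fin 1 × Fin n)) ≃g (⊤ : SimpleGraph (Fin 1 × Fin n))) :=
    fun d => ⟨relabel (Equiv.refl _) (fun _ => d), by simp⟩
  suffices ∃ d, ∀ a b c : Fin n, a < b → b < c →
      ℓ (s((0, a), (0, b)).map (σ d)) < ℓ (s((0, b), (0, c)).map (σ d)) by
    obtain ⟨d, h⟩ := this
    obtain ⟨c, hc⟩ := exists_completeLt_of_consecutive (injOn_comp_iso hℓ (σ d))
      (hom.relabel (Equiv.refl _) fun _ => d) hn h
    exact ⟨c, σ d, hc⟩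
  rcases Homogeneous.lt_or_lt (m := 3) (i := 0) (j := 1) (i' := 1) (j' := 2) hℓ hom
      (by decide) (by decide) (by decide) with h | h
  · exact ⟨true, fun a b c h1 h2 => h _ (strictMono_vec₃ h1 h2)⟩
  · refine ⟨false, fun a b c h1 h2 => ?_⟩
    have := h _ (strictMono_vec₃ (Fin.rev_lt_rev.2 h2) (Fin.rev_lt_rev.2 h1))
    rw [Sym2.eq_swap, Sym2.eq_swap (b := (0, c))]
    exact this

end Complete

/-! ### Homogeneous orders of complete tripartite graphs -/

section Blocks

variable {k n : ℕ} (ℓ : Sym2 (Fin k × Fin n) → ℕ)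

/-- All edges between classes `i` and `j` precede all edges between classes `i` and `m`. -/
def EdgesBefore (i j m : Fin k) : Prop :=
  ∀ a b a' c, ℓ s((i, a), (j, b)) < ℓ s((i, a'), (m, c))

/-- The edges between classes `i` and `j` and those between `i` and `m` are primarily ordered by
the vertex in class `i`, in the direction `d`, and the two kinds of edges alternate. -/
def Interleaved (i j m : Fin k) (d : Bool) : Prop :=
  ∀ a a' b c, orient d a < orient d a' → ℓ s((i, a), (j, b)) < ℓ s((i, a'), (m, c)) ∧
    ℓ s((i, a), (m, c)) < ℓ s((i, a'), (j, b))

/-- Among the edges at a common vertex of class `i`, those to class `j` precede those to `m`. -/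
def TieFirst (i j m : Fin k) : Prop :=
  ∀ a b c, ℓ s((i, a), (j, b)) < ℓ s((i, a), (m, c))

variable {ℓ}

theorem Interleaved.symm {i j m : Fin k} {d : Bool} (h : Interleaved ℓ i j m d) :
    Interleaved ℓ i m j d := fun a a' b c hlt => (h a a' c b hlt).symm

/-- Squeeze an edge between classes `i` and `m` between two edges whose vertices in class `i` are
the first and the last of three vertices. -/
theorem Interleaved.primary (hom : Homogeneous ℓ) {i j m : Fin k} (hij : i ≠ j) {d : Bool}
    (h : Interleaved ℓ i j m d) {x y z : Fin n} (hxy : x < y) (hyz : y < z) :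
    Primary ℓ i j d := by
  intro a a' b b' ha
  have hxy' : orient d (orient d x) < orient d (orient d y) := by rwa [orient_orient, orient_orient]
  have hyz' : orient d (orient d y) < orient d (orient d z) := by rwa [orient_orient, orient_orient]
  exact (hom.pair hij (SameCmp.of_orient (hxy'.trans hyz') ha) SameCmp.rfl).1
    ((h _ _ b x hxy').1.trans (h _ _ b' x hyz').2)

theorem lt_or_lt_of_sameCmp (hℓ : Set.InjOn ℓ (multipartite k n).edgeSet) (hom : Homogeneous ℓ)
    {i j m : Fin k} (hij : i ≠ j) (him : i ≠ m) (hjm : j ≠ m) (x x' : Fin n) :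
    (∀ a a' b c, SameCmp x x' a a' → ℓ s((i, a), (j, b)) < ℓ s((i, a'), (m, c))) ∨
    (∀ a a' b c, SameCmp x x' a a' → ℓ s((i, a'), (m, c)) < ℓ s((i, a), (j, b))) := by
  by_cases h : ℓ s((i, x), (j, x)) < ℓ s((i, x'), (m, x))
  · exact Or.inl fun a a' b c hs => (hom.share hij him hjm hs _ _ _ _).1 h
  · refine Or.inr fun a a' b c hs => lt_of_not_lt hℓ hij him (by simp [him, hjm]) fun h' => ?_
    exact h ((hom.share hij him hjm hs x x b c).2 h')

/-- The edges from a class to one class and those to another one either are separated or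
alternate: the comparison of an edge from `a` with an edge from `a'` depends only on the relative
position of `a` and `a'`, and the other possibilities for this dependence contradict
transitivity. -/
theorem edgesBefore_or_interleaved (hℓ : Set.InjOn ℓ (multipartite k n).edgeSet)
    (hom : Homogeneous ℓ) {i j m : Fin k} (hij : i ≠ j) (him : i ≠ m) (hjm : j ≠ m)
    {x y : Fin n} (hxy : x < y) :
    EdgesBefore ℓ i j m ∨ EdgesBefore ℓ i m j ∨
      ∃ d, Interleaved ℓ i j m d ∧ (TieFirst ℓ i j m ∨ TieFirst ℓ i m j) := by
  have htie : TieFirst ℓ i j m ∨ TieFirst ℓ i m j :=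
    (lt_or_lt_of_sameCmp hℓ hom hij him hjm x x).imp (fun h a b c => h a a b c SameCmp.of_eq)
      fun h a b c => h a a c b SameCmp.of_eq
  have hlt : (∀ a a' b c, a < a' → ℓ s((i, a), (j, b)) < ℓ s((i, a'), (m, c))) ∨
      (∀ a a' b c, a < a' → ℓ s((i, a'), (m, c)) < ℓ s((i, a), (j, b))) :=
    (lt_or_lt_of_sameCmp hℓ hom hij him hjm x y).imp
      (fun h a a' b c ha => h a a' b c (SameCmp.of_lt hxy ha))
      fun h a a' b c ha => h a a' b c (SameCmp.of_lt hxy ha)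
  have hgt : (∀ a a' b c, a' < a → ℓ s((i, a), (j, b)) < ℓ s((i, a'), (m, c))) ∨
      (∀ a a' b c, a' < a → ℓ s((i, a'), (m, c)) < ℓ s((i, a), (j, b))) :=
    (lt_or_lt_of_sameCmp hℓ hom hij him hjm y x).imp
      (fun h a a' b c ha => h a a' b c (SameCmp.of_gt hxy ha))
      fun h a a' b c ha => h a a' b c (SameCmp.of_gt hxy ha)
  rcases hlt with hlt | hlt <;> rcases hgt with hgt | hgt
  · rcases htie with htie | htie
    · left
      intro a b a' c
      rcases lt_trichotomy a a' with h | rfl | h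
      · exact hlt a a' b c h
      · exact htie a b c
      · exact hgt a a' b c h
    · have h1 := htie x x x
      have h2 := htie y x x
      have h3 := hlt x y x x hxy
      have h4 := hgt y x x x hxy
      omega
  · exact Or.inr (Or.inr ⟨true, fun a a' b c h => ⟨hlt a a' b c h, hgt a' a b c h⟩, htie⟩)
  · refine Or.inr (Or.inr ⟨false, fun a a' b c h => ?_, htie⟩)
    have h' : a' < a := Fin.rev_lt_rev.1 h
    exact ⟨hgt a a' b c h', hlt a' a b c h'⟩
  · rcases htie with htie | htie
    · have h1 := htie x x x
      have h2 := htie y x x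
      have h3 := hlt x y x x hxy
      have h4 := hgt y x x x hxy
      omega
    · right; left
      intro a c a' b
      rcases lt_trichotomy a' a with h | rfl | h
      · exact hlt a' a b c h
      · exact htie a' c b
      · exact hgt a' a b c h

variable (ℓ) in
/-- Between classes `i` and `j` the order is lexicographic, with directions `d` and `d'` on the two
classes, class `i` being primary if `p` holds and class `j` otherwise. -/
def LexBetween (i j : Fin k) (d d' p : Bool) : Prop :=
  FixedDir ℓ i j d ∧ FixedDir ℓ j i d' ∧ if p then Primary ℓ i j d else Primary ℓ j i d'

theorem exists_lexBetween (hℓ : Set.InjOn ℓ (multipartite k n).edgeSet) (hom : Homogeneous ℓ)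
    {i j : Fin k} (hij : i ≠ j) {d d' : Bool} (hd : FixedDir ℓ i j d) (hd' : FixedDir ℓ j i d') :
    ∃ p, LexBetween ℓ i j d d' p := by
  rcases primary_or_primary hℓ hom hij hd hd' with h | h
  · exact ⟨true, hd, hd', h⟩
  · exact ⟨false, hd, hd', h⟩

theorem LexBetween.lt {i j : Fin k} {d d' p : Bool} (h : LexBetween ℓ i j d d' p)
    {a b a' b' : Fin n}
    (hlt : (if p then orient d a else orient d' b) < (if p then orient d a' else orient d' b') ∨
      (if p then orient d a else orient d' b) = (if p then orient d a' else orient d' b') ∧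
        (if p then orient d' b else orient d a) < (if p then orient d' b' else orient d a')) :
    ℓ s((i, a), (j, b)) < ℓ s((i, a'), (j, b')) := by
  obtain ⟨hd, hd', hp⟩ := h
  cases p
  · rw [Sym2.eq_swap, Sym2.eq_swap (a := (i, a'))]
    rcases hlt with hlt | ⟨heq, hlt⟩
    · exact hp _ _ _ _ hlt
    · obtain rfl : b = b' := orient_inj.1 heq
      rw [Sym2.eq_swap, Sym2.eq_swap (a := (j, b))]
      exact hd _ _ _ hlt
  · rcases hlt with hlt | ⟨heq, hlt⟩
    · exact hp _ _ _ _ hlt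
    · obtain rfl : a = a' := orient_inj.1 heq
      rw [Sym2.eq_swap, Sym2.eq_swap (a := (i, a))]
      exact hd' _ _ _ hlt

end Blocks

section Tripartite

variable {n : ℕ}

/-- The smaller class of the three pairs of classes `01`, `02`, `12`. -/
def fstClass : Fin 3 → Fin 3 := ![0, 0, 1]

/-- The larger class of the three pairs of classes `01`, `02`, `12`. -/
def sndClass : Fin 3 → Fin 3 := ![1, 2, 2]

/-- The edge between vertex `a` of the smaller and vertex `b` of the larger class of the pair of
classes with index `m`, for `x = (m, a, b)`. -/
def tripartiteEdge (x : Fin 3 × Fin n × Fin n) : Sym2 (Fin 3 × Fin n) :=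
  s((fstClass x.1, x.2.1), (sndClass x.1, x.2.2))

theorem exists_tripartiteEdge_eq :
    ∀ e ∈ (multipartite 3 n).edgeSet, ∃ x, tripartiteEdge x = e := by
  have hcl : ∀ i j : Fin 3, i ≠ j → ∃ m, (fstClass m = i ∧ sndClass m = j) ∨
      (fstClass m = j ∧ sndClass m = i) := by decide
  intro e he
  induction e using Sym2.ind with
  | _ x y =>
    obtain ⟨i, a⟩ := x
    obtain ⟨j, b⟩ := y
    obtain ⟨m, ⟨rfl, rfl⟩ | ⟨rfl, rfl⟩⟩ := hcl i j he
    · exact ⟨(m, a, b), rfl⟩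
    · exact ⟨(m, b, a), Sym2.eq_swap⟩

/-- A description of an order of the edges of a complete tripartite graph. For each of the three
pairs of classes, it consists of a rank, of the position among pairs of classes of the same rank, of
which of the two classes is primary (the smaller one if `prim`), and of the directions on the two
classes. -/
structure TripartiteOrder where
  /-- the primary criterion for comparing edges -/
  rank : Fin 3 → ℕ
  /-- the criterion for edges of the same rank with equal primary vertices -/
  tie : Fin 3 → ℕ
  /-- whether the vertex in the smaller class is the primary one -/
  prim : Fin 3 → Bool
  /-- the direction on the smaller class -/
  dirFst : Fin 3 → Bool
  /-- the direction on the larger class -/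
  dirSnd : Fin 3 → Bool

namespace TripartiteOrder

variable (D : TripartiteOrder)

/-- The position of the primary vertex of an edge, in the direction of its class. -/
def primary (x : Fin 3 × Fin n × Fin n) : Fin n :=
  if D.prim x.1 then orient (D.dirFst x.1) x.2.1 else orient (D.dirSnd x.1) x.2.2

/-- The position of the other vertex of an edge, in the direction of its class. -/
def secondary (x : Fin 3 × Fin n × Fin n) : Fin n :=
  if D.prim x.1 then orient (D.dirSnd x.1) x.2.2 else orient (D.dirFst x.1) x.2.1

/-- The lexicographic order by rank, primary vertex, tie-breaking position, other vertex. -/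
def Lt (x y : Fin 3 × Fin n × Fin n) : Prop :=
  D.rank x.1 < D.rank y.1 ∨ D.rank x.1 = D.rank y.1 ∧ (D.primary x < D.primary y ∨
    D.primary x = D.primary y ∧ (D.tie x.1 < D.tie y.1 ∨
      D.tie x.1 = D.tie y.1 ∧ D.secondary x < D.secondary y))

variable {D}

theorem lt_trichotomy (hD : ∀ m m', D.rank m = D.rank m' → D.tie m = D.tie m' → m = m')
    (x y : Fin 3 × Fin n × Fin n) : D.Lt x y ∨ x = y ∨ D.Lt y x := by
  unfold Lt
  rcases _root_.lt_trichotomy (D.rank x.1) (D.rank y.1) with h₁ | h₁ | h₁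
  · simp [h₁]
  · rcases _root_.lt_trichotomy (D.primary x) (D.primary y) with h₂ | h₂ | h₂
    · simp [h₁, h₂]
    · rcases _root_.lt_trichotomy (D.tie x.1) (D.tie y.1) with h₃ | h₃ | h₃
      · simp [h₁, h₂, h₃]
      · rcases _root_.lt_trichotomy (D.secondary x) (D.secondary y) with h₄ | h₄ | h₄
        · simp [h₁, h₂, h₃, h₄]
        · right; left
          obtain ⟨m, a, b⟩ := x
          obtain ⟨m', a', b'⟩ := y
          obtain rfl : m = m' := hD _ _ h₁ h₃
          simp only [primary, secondary] at h₂ h₄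
          split_ifs at h₂ h₄
          · rw [orient_inj.1 h₂, orient_inj.1 h₄]
          · rw [orient_inj.1 h₂, orient_inj.1 h₄]
        · simp [h₁, h₂, h₃, h₄]
      · simp [h₁, h₂, h₃]
    · simp [h₁, h₂]
  · simp [h₁]

theorem label_lt_of_lt {ℓ : Sym2 (Fin 3 × Fin n) → ℕ}
    (hlex : ∀ m, LexBetween ℓ (fstClass m) (sndClass m) (D.dirFst m) (D.dirSnd m) (D.prim m))
    (hne : ∀ m a b m' a' b', m ≠ m' → D.Lt (m, a, b) (m', a', b') →
      ℓ (tripartiteEdge (m, a, b)) < ℓ (tripartiteEdge (m', a', b')))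
    (x y : Fin 3 × Fin n × Fin n) (h : D.Lt x y) :
    ℓ (tripartiteEdge x) < ℓ (tripartiteEdge y) := by
  obtain ⟨m, a, b⟩ := x
  obtain ⟨m', a', b'⟩ := y
  by_cases hm : m = m'
  · subst hm
    refine (hlex m).lt ?_
    simpa [Lt, primary, secondary] using h
  · exact hne m a b m' a' b' hm h

end TripartiteOrder

/-- The 64 normalized orders in which the three pairs of classes follow each other, and the 16 in
which the pairs `01` and `02` alternate. In both cases three directions are normalized by the choice
of the numbering of each class; when two pairs of classes alternate, class `0` is primary in both
and has the same direction in both. -/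
def normalOrder : (Fin 6 → Bool) ⊕ (Fin 4 → Bool) → TripartiteOrder
  | .inl f => ⟨![0, 1, 2], ![0, 0, 0], ![f 0, f 1, f 2], ![true, f 3, f 4], ![true, true, f 5]⟩
  | .inr f => ⟨![1, 1, if f 0 then 0 else 2], ![0, 1, 0], ![true, true, f 1], ![true, true, f 2],
      ![true, true, f 3]⟩

theorem normalOrder_injective (c : (Fin 6 → Bool) ⊕ (Fin 4 → Bool)) (m m' : Fin 3)
    (h : (normalOrder c).rank m = (normalOrder c).rank m')
    (h' : (normalOrder c).tie m = (normalOrder c).tie m') : m = m' := by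
  rcases c with f | f
  · revert h h'
    fin_cases m <;> fin_cases m' <;> simp [normalOrder]
  · revert h h'
    cases hf : f 0 <;> fin_cases m <;> fin_cases m' <;> simp [normalOrder, hf]

variable {ℓ : Sym2 (Fin 3 × Fin n) → ℕ}

theorem exists_normalOrder_of_separated (hℓ : Set.InjOn ℓ (multipartite 3 n).edgeSet)
    (hom : Homogeneous ℓ) (h₁ : EdgesBefore ℓ 0 1 2) (h₂ : EdgesBefore ℓ 2 0 1)
    (hd₀ : FixedDir ℓ 0 1 true) (hd₁ : FixedDir ℓ 1 0 true) (hd₂ : FixedDir ℓ 2 0 true) :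
    ∃ c, ∀ x y, (normalOrder c).Lt x y → ℓ (tripartiteEdge x) < ℓ (tripartiteEdge y) := by
  obtain ⟨d₀₂, hd₀₂⟩ := exists_fixedDir hℓ hom (i := 0) (j := 2) (by decide)
  obtain ⟨d₁₂, hd₁₂⟩ := exists_fixedDir hℓ hom (i := 1) (j := 2) (by decide)
  obtain ⟨d₂₁, hd₂₁⟩ := exists_fixedDir hℓ hom (i := 2) (j := 1) (by decide)
  obtain ⟨p₀, hp₀⟩ := exists_lexBetween hℓ hom (by decide) hd₀ hd₁
  obtain ⟨p₁, hp₁⟩ := exists_lexBetween hℓ hom (by decide) hd₀₂ hd₂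
  obtain ⟨p₂, hp₂⟩ := exists_lexBetween hℓ hom (by decide) hd₁₂ hd₂₁
  have h₂' : ∀ a b a' b', ℓ s((0, a), (2, b)) < ℓ s((1, a'), (2, b')) := by
    intro a b a' b'
    rw [Sym2.eq_swap, Sym2.eq_swap (a := (1, a'))]
    exact h₂ b a b' a'
  refine ⟨.inl ![p₀, p₁, p₂, d₀₂, d₁₂, d₂₁], TripartiteOrder.label_lt_of_lt ?_ ?_⟩
  · intro m
    fin_cases m
    · exact hp₀
    · exact hp₁
    · exact hp₂
  · intro m a b m' a' b' hm h
    have hlt : m < m' := by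
      rcases h with h | ⟨h, -⟩ <;> revert h hm <;> fin_cases m <;> fin_cases m' <;>
        simp [normalOrder]
    clear h hm
    fin_cases m <;> fin_cases m' <;> first | exact absurd hlt (by decide) | skip
    · exact h₁ a b a' b'
    · exact (h₁ a b a a').trans (h₂' a a' a' b')
    · exact h₂' a b a' b'

theorem exists_normalOrder_of_interleaved (hℓ : Set.InjOn ℓ (multipartite 3 n).edgeSet)
    (hom : Homogeneous ℓ) {x y z : Fin n} (hxy : x < y) (hyz : y < z)
    (hint : Interleaved ℓ 0 1 2 true) (htie : TieFirst ℓ 0 1 2)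
    (hd₁ : FixedDir ℓ 1 0 true) (hd₂ : FixedDir ℓ 2 0 true) :
    ∃ c, ∀ x y, (normalOrder c).Lt x y → ℓ (tripartiteEdge x) < ℓ (tripartiteEdge y) := by
  have hP₁ : Primary ℓ 0 1 true := hint.primary hom (by decide) hxy hyz
  have hP₂ : Primary ℓ 0 2 true := hint.symm.primary hom (by decide) hxy hyz
  obtain ⟨d₁₂, hd₁₂⟩ := exists_fixedDir hℓ hom (i := 1) (j := 2) (by decide)
  obtain ⟨d₂₁, hd₂₁⟩ := exists_fixedDir hℓ hom (i := 2) (j := 1) (by decide)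
  obtain ⟨p₂, hp₂⟩ := exists_lexBetween hℓ hom (by decide) hd₁₂ hd₂₁
  -- class `0` is primary in both `01` and `02`, so `12` alternates with neither of them
  have h₁ : EdgesBefore ℓ 1 0 2 ∨ EdgesBefore ℓ 1 2 0 := by
    rcases edgesBefore_or_interleaved hℓ hom (i := 1) (j := 0) (m := 2) (by decide) (by decide)
      (by decide) hxy with h | h | ⟨d, h, -⟩
    · exact Or.inl h
    · exact Or.inr h
    · exact (not_primary_and_primary hxy hP₁ (h.primary hom (by decide) hxy hyz)).elim
  have h₂ : EdgesBefore ℓ 2 0 1 ∨ EdgesBefore ℓ 2 1 0 := by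
    rcases edgesBefore_or_interleaved hℓ hom (i := 2) (j := 0) (m := 1) (by decide) (by decide)
      (by decide) hxy with h | h | ⟨d, h, -⟩
    · exact Or.inl h
    · exact Or.inr h
    · exact (not_primary_and_primary hxy hP₂ (h.primary hom (by decide) hxy hyz)).elim
  have h01 : ∀ a b a' b', orient true a < orient true a' →
      ℓ s((0, a), (1, b)) < ℓ s((0, a'), (2, b')) := fun a b a' b' h => (hint a a' b b' h).1
  have h10 : ∀ a b a' b', orient true a < orient true a' →
      ℓ s((0, a), (2, b)) < ℓ s((0, a'), (1, b')) := fun a b a' b' h => (hint a a' b' b h).2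
  have hlex : ∀ q m, LexBetween ℓ (fstClass m) (sndClass m)
      ((normalOrder (.inr ![q, p₂, d₁₂, d₂₁])).dirFst m)
      ((normalOrder (.inr ![q, p₂, d₁₂, d₂₁])).dirSnd m)
      ((normalOrder (.inr ![q, p₂, d₁₂, d₂₁])).prim m) := by
    intro q m
    fin_cases m
    · exact ⟨hP₁.fixedDir, hd₁, hP₁⟩
    · exact ⟨hP₂.fixedDir, hd₂, hP₂⟩
    · exact hp₂
  -- the comparison of the pairs `01` and `02` is the same in all cases
  have h₀₁ : ∀ q a b a' b', (normalOrder (.inr ![q, p₂, d₁₂, d₂₁])).Lt (0, a, b) (1, a', b') →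
      ℓ s((0, a), (1, b)) < ℓ s((0, a'), (2, b')) := by
    rintro q a b a' b' (h | ⟨-, h | ⟨h, -⟩⟩)
    · exact absurd h (lt_irrefl 1)
    · exact h01 a b a' b' h
    · obtain rfl : a = a' := h
      exact htie a b b'
  have h₁₀ : ∀ q a b a' b', (normalOrder (.inr ![q, p₂, d₁₂, d₂₁])).Lt (1, a, b) (0, a', b') →
      ℓ s((0, a), (2, b)) < ℓ s((0, a'), (1, b')) := by
    rintro q a b a' b' (h | ⟨-, h | ⟨h, h' | ⟨h', -⟩⟩⟩)
    · exact absurd h (lt_irrefl 1)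
    · exact h10 a b a' b' h
    · exact absurd h' (by simp [normalOrder])
    · exact absurd h' (by simp [normalOrder])
  have hsep : (∀ a b a' b', ℓ s((1, a), (2, b)) < ℓ s((0, a'), (1, b')) ∧
        ℓ s((1, a), (2, b)) < ℓ s((0, a'), (2, b'))) ∨
      (∀ a b a' b', ℓ s((0, a'), (1, b')) < ℓ s((1, a), (2, b)) ∧
        ℓ s((0, a'), (2, b')) < ℓ s((1, a), (2, b))) := by
    have e₁ : ∀ a b : Fin n, s(((0 : Fin 3), a), ((1 : Fin 3), b)) = s((1, b), (0, a)) :=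
      fun _ _ => Sym2.eq_swap
    have e₂ : ∀ a b : Fin n, s(((0 : Fin 3), a), ((2 : Fin 3), b)) = s((2, b), (0, a)) :=
      fun _ _ => Sym2.eq_swap
    have e₃ : ∀ a b : Fin n, s(((1 : Fin 3), a), ((2 : Fin 3), b)) = s((2, b), (1, a)) :=
      fun _ _ => Sym2.eq_swap
    -- if `12` lay between `01` and `02`, these would not alternate
    rcases h₁ with h₁ | h₁ <;> rcases h₂ with h₂ | h₂
    · refine Or.inr fun a b a' b' => ⟨?_, ?_⟩
      · rw [e₁]; exact h₁ _ _ _ _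
      · rw [e₂, e₃]; exact h₂ _ _ _ _
    · exfalso
      have i₁ := h₁ x y x x
      have i₂ := h₂ x x x x
      have i₃ := h10 x x y x hxy
      rw [← e₁] at i₁
      rw [← e₂, ← e₃] at i₂
      omega
    · exfalso
      have i₁ := h₁ x x x x
      have i₂ := h₂ x y x x
      have i₃ := h01 x x y x hxy
      rw [← e₁] at i₁
      rw [← e₂, ← e₃] at i₂
      omega
    · refine Or.inl fun a b a' b' => ⟨?_, ?_⟩
      · rw [e₁]; exact h₁ _ _ _ _
      · rw [e₂, e₃]; exact h₂ _ _ _ _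
  rcases hsep with hsep | hsep
  · refine ⟨.inr ![true, p₂, d₁₂, d₂₁], TripartiteOrder.label_lt_of_lt (hlex true) ?_⟩
    intro m a b m' a' b' hm h
    fin_cases m <;> fin_cases m' <;> first | exact absurd rfl hm | skip
    · exact h₀₁ _ a b a' b' h
    · simp [normalOrder, TripartiteOrder.Lt] at h
    · exact h₁₀ _ a b a' b' h
    · simp [normalOrder, TripartiteOrder.Lt] at h
    · exact (hsep a b a' b').1
    · exact (hsep a b a' b').2
  · refine ⟨.inr ![false, p₂, d₁₂, d₂₁], TripartiteOrder.label_lt_of_lt (hlex false) ?_⟩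
    intro m a b m' a' b' hm h
    fin_cases m <;> fin_cases m' <;> first | exact absurd rfl hm | skip
    · exact h₀₁ _ a b a' b' h
    · exact (hsep a' b' a b).1
    · exact h₁₀ _ a b a' b' h
    · exact (hsep a' b' a b).2
    · simp [normalOrder, TripartiteOrder.Lt] at h
    · simp [normalOrder, TripartiteOrder.Lt] at h

/-- Either the three pairs of classes follow each other, or two of them alternate. -/
theorem exists_separated_or_interleaved (hℓ : Set.InjOn ℓ (multipartite 3 n).edgeSet)
    (hom : Homogeneous ℓ) {x y : Fin n} (hxy : x < y) :
    ∃ i j m : Fin 3, i ≠ j ∧ i ≠ m ∧ j ≠ m ∧ ((EdgesBefore ℓ i j m ∧ EdgesBefore ℓ m i j) ∨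
      ∃ d, Interleaved ℓ i j m d ∧ TieFirst ℓ i j m) := by
  have main : ∀ {i j m : Fin 3}, i ≠ j → i ≠ m → j ≠ m →
      EdgesBefore ℓ i j m ∨ EdgesBefore ℓ i m j ∨ ∃ i j m : Fin 3, i ≠ j ∧ i ≠ m ∧ j ≠ m ∧
        ∃ d, Interleaved ℓ i j m d ∧ TieFirst ℓ i j m := by
    intro i j m hij him hjm
    rcases edgesBefore_or_interleaved hℓ hom hij him hjm hxy with h | h | ⟨d, h, ht | ht⟩
    · exact Or.inl h
    · exact Or.inr (Or.inl h)
    · exact Or.inr (Or.inr ⟨i, j, m, hij, him, hjm, d, h, ht⟩)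
    · exact Or.inr (Or.inr ⟨i, m, j, him, hij, hjm.symm, d, h.symm, ht⟩)
  by_cases hmix : ∃ i j m : Fin 3, i ≠ j ∧ i ≠ m ∧ j ≠ m ∧
      ∃ d, Interleaved ℓ i j m d ∧ TieFirst ℓ i j m
  · obtain ⟨i, j, m, h₁, h₂, h₃, h⟩ := hmix
    exact ⟨i, j, m, h₁, h₂, h₃, Or.inr h⟩
  have main' : ∀ {i j m : Fin 3}, i ≠ j → i ≠ m → j ≠ m →
      EdgesBefore ℓ i j m ∨ EdgesBefore ℓ i m j := fun h₁ h₂ h₃ =>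
    (main h₁ h₂ h₃).imp_right fun h => h.resolve_right hmix
  have h₀ := main' (i := 0) (j := 1) (m := 2) (by decide) (by decide) (by decide)
  have h₁ := main' (i := 1) (j := 0) (m := 2) (by decide) (by decide) (by decide)
  have h₂ := main' (i := 2) (j := 0) (m := 1) (by decide) (by decide) (by decide)
  rcases h₀ with h₀ | h₀ <;> rcases h₂ with h₂ | h₂
  · exact ⟨0, 1, 2, by decide, by decide, by decide, Or.inl ⟨h₀, h₂⟩⟩
  · rcases h₁ with h₁ | h₁
    · exact ⟨1, 0, 2, by decide, by decide, by decide, Or.inl ⟨h₁, h₂⟩⟩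
    · exact ⟨1, 2, 0, by decide, by decide, by decide, Or.inl ⟨h₁, h₀⟩⟩
  · rcases h₁ with h₁ | h₁
    · exact ⟨0, 2, 1, by decide, by decide, by decide, Or.inl ⟨h₀, h₁⟩⟩
    · exact ⟨2, 0, 1, by decide, by decide, by decide, Or.inl ⟨h₂, h₁⟩⟩
  · exact ⟨2, 1, 0, by decide, by decide, by decide, Or.inl ⟨h₂, h₀⟩⟩

theorem exists_perm_fin_three {i j m : Fin 3} (hij : i ≠ j) (him : i ≠ m) (hjm : j ≠ m) :
    ∃ π : Equiv.Perm (Fin 3), π 0 = i ∧ π 1 = j ∧ π 2 = m := by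
  revert i j m
  decide

/-- Up to relabelling, the homogeneous orders of a complete tripartite graph are the 80 normalized
ones. -/
theorem exists_follows_normalOrder (hℓ : Set.InjOn ℓ (multipartite 3 n).edgeSet)
    (hom : Homogeneous ℓ) {x y z : Fin n} (hxy : x < y) (hyz : y < z) :
    ∃ c, Follows (multipartite 3 n) tripartiteEdge (normalOrder c).Lt ℓ := by
  obtain ⟨i, j, m, hij, him, hjm, h⟩ := exists_separated_or_interleaved hℓ hom hxy
  obtain ⟨π, rfl, rfl, rfl⟩ := exists_perm_fin_three hij him hjm
  obtain ⟨d₁, hd₁⟩ := exists_fixedDir hℓ hom hij.symm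
  obtain ⟨d₂, hd₂⟩ := exists_fixedDir hℓ hom him.symm
  let σ : (Fin 3 → Bool) → (multipartite 3 n ≃g multipartite 3 n) :=
    fun d => ⟨relabel π d, fun {a b} => π.injective.ne_iff⟩
  -- numbering each class in the given direction makes the directions positive
  have hdir : ∀ (d : Fin 3 → Bool) (i j : Fin 3), FixedDir ℓ (π i) (π j) (d i) →
      FixedDir (fun e => ℓ (e.map (σ d))) i j true := by
    intro d i j h a a' b ha
    exact h _ _ _ (by rw [orient_orient, orient_orient]; exact ha)
  rcases h with ⟨h₁, h₂⟩ | ⟨d₀, hint, htie⟩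
  · obtain ⟨d₀, hd₀⟩ := exists_fixedDir hℓ hom hij
    obtain ⟨c, hc⟩ := exists_normalOrder_of_separated (injOn_comp_iso hℓ (σ ![d₀, d₁, d₂]))
      (hom.relabel π _) (fun _ _ _ _ => h₁ _ _ _ _) (fun _ _ _ _ => h₂ _ _ _ _)
      (hdir _ 0 1 hd₀) (hdir _ 1 0 hd₁) (hdir _ 2 0 hd₂)
    exact ⟨c, σ ![d₀, d₁, d₂], hc⟩
  · obtain ⟨c, hc⟩ := exists_normalOrder_of_interleaved (injOn_comp_iso hℓ (σ ![d₀, d₁, d₂]))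
      (hom.relabel π _) hxy hyz
      (fun a a' b c h => hint _ _ _ _ (by
        change orient d₀ (orient d₀ a) < orient d₀ (orient d₀ a')
        rwa [orient_orient, orient_orient]))
      (fun _ _ _ => htie _ _ _) (hdir _ 1 0 hd₁) (hdir _ 2 0 hd₂)
    exact ⟨c, σ ![d₀, d₁, d₂], hc⟩

end Tripartite

/-! ### Complete multipartite hosts and the final argument -/

theorem multipartite_mapClasses {k : ℕ} : ∀ n N (ψ : Fin k → Fin n → Fin N),
    (∀ i, StrictMono (ψ i)) → ∀ x y, (multipartite k n).Adj x y →
      (multipartite k N).Adj (mapClasses ψ x) (mapClasses ψ y) :=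
  fun _ _ _ _ _ _ h => h

theorem top_mapClasses {k : ℕ} : ∀ n N (ψ : Fin k → Fin n → Fin N),
    (∀ i, StrictMono (ψ i)) → ∀ x y, (⊤ : SimpleGraph (Fin k × Fin n)).Adj x y →
      (⊤ : SimpleGraph (Fin k × Fin N)).Adj (mapClasses ψ x) (mapClasses ψ y) := by
  rintro n N ψ hψ ⟨i, a⟩ ⟨j, b⟩ h heq
  simp only [mapClasses, Prod.mk.injEq] at heq
  obtain ⟨rfl, heq⟩ := heq
  exact h (by rw [(hψ i).injective heq])

theorem chromaticNumber_multipartite_le (k n : ℕ) :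
    (multipartite k n).chromaticNumber ≤ k :=
  SimpleGraph.Colorable.chromaticNumber_le
    ⟨SimpleGraph.Coloring.mk Prod.fst fun h => h⟩

/-- If a `k`-colourable graph cannot avoid a family, then neither can the complete `k`-partite
graphs with sufficiently many vertices in each class. -/
theorem not_canAvoid_multipartite {V : Type} [Finite V] {G : SimpleGraph V} {k : ℕ}
    (hG : G.Colorable k) {ℋ : Set EdgeOrderedGraph.{u}} (h : ¬ CanAvoid G ℋ) {n : ℕ}
    (hn : Nat.card V ≤ n) : ¬ CanAvoid (multipartite k n) ℋ := by
  obtain ⟨C⟩ := hG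
  let f : G →g multipartite k n :=
    ⟨fun v => (C v, Fin.castLE hn (Finite.equivFin V v)), fun h => C.valid h⟩
  refine not_canAvoid_of_copy ⟨f, fun v w hvw => ?_⟩ h
  exact (Finite.equivFin V).injective (Fin.castLE_injective hn (congrArg Prod.snd hvw))

theorem not_canAvoid_top {V : Type} [Finite V] {G : SimpleGraph V}
    {ℋ : Set EdgeOrderedGraph.{u}} (h : ¬ CanAvoid G ℋ) {n : ℕ} (hn : Nat.card V ≤ n) :
    ¬ CanAvoid (⊤ : SimpleGraph (Fin 1 × Fin n)) ℋ := by
  let f : V → Fin 1 × Fin n := fun v => (0, Fin.castLE hn (Finite.equivFin V v))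
  have hf : Function.Injective f := fun v w hvw =>
    (Finite.equivFin V).injective (Fin.castLE_injective hn (congrArg Prod.snd hvw))
  exact not_canAvoid_of_copy ⟨⟨f, fun h => hf.ne h.ne⟩, hf⟩ h

theorem exists_not_canAvoid_multipartite {ℋ : Set EdgeOrderedGraph.{u}} {k : ℕ}
    (h : orderChromaticNumber ℋ = k) :
    ∃ n, ∀ N, n ≤ N → ¬ CanAvoid (multipartite k N) ℋ := by
  obtain ⟨V, hV, G, hG, hχ⟩ := exists_not_canAvoid (ℋ := ℋ) (by rw [h]; exact ENat.natCast_ne_top k)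
  exact ⟨Nat.card V, fun N hN => not_canAvoid_multipartite
    (SimpleGraph.chromaticNumber_le_iff_colorable.1 (hχ.trans h).le) hG hN⟩

theorem orderChromaticNumber_singleton_of_contains {G : EdgeOrderedGraph.{u}} (hG : G.HasEdge)
    {n : ℕ} (h : (canonicalBipartite n).Contains G) : orderChromaticNumber {G} = 2 := by
  refine le_antisymm ?_ (two_le_orderChromaticNumber (by simpa using hG))
  obtain ⟨N, hN⟩ := exists_forall_contains_homogeneous (multipartite_mapClasses (k := 2)) n
  have : ¬ CanAvoid (multipartite 2 N) {G} := by
    refine not_canAvoid_iff.2 fun ℓ hℓ => ⟨G, rfl, ?_⟩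
    obtain ⟨ℓ', hℓ', hhom, hc⟩ := hN ℓ hℓ
    exact Contains.trans hc (Contains.trans (contains_canonicalBipartite hℓ' hhom) h)
  exact (orderChromaticNumber_le this).trans (chromaticNumber_multipartite_le 2 N)

/-- The canonical order of `K_{n,n}`, as an order of the complete bipartite host graph, has to
contain a member of a family of order chromatic number 2. -/
theorem exists_canonicalBipartite_contains {ℋ : Set EdgeOrderedGraph.{u}}
    (h : orderChromaticNumber ℋ = 2) : ∃ G ∈ ℋ, ∃ n, (canonicalBipartite n).Contains G := by
  obtain ⟨n, hn⟩ := exists_not_canAvoid_multipartite (k := 2) h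
  let f : Fin 2 × Fin n → Fin n ⊕ Fin n := fun x => if x.1 = 0 then .inl x.2 else .inr x.2
  have hf : Function.Injective f := by
    rintro ⟨i, a⟩ ⟨j, b⟩ h
    fin_cases i <;> fin_cases j <;> simp_all [f]
  have hcopy : SimpleGraph.Copy (multipartite 2 n) (completeBipartiteGraph (Fin n) (Fin n)) := by
    refine ⟨⟨f, ?_⟩, hf⟩
    rintro ⟨i, a⟩ ⟨j, b⟩ h
    rw [multipartite_adj] at h
    fin_cases i <;> fin_cases j <;> simp_all [f]
  obtain ⟨G, hG, hc⟩ := not_canAvoid_iff.1 (not_canAvoid_of_copy hcopy (hn n le_rfl))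
    (canonicalLabel n) (canonicalLabel_injOn n)
  exact ⟨G, hG, n, hc⟩

theorem exists_subfamily_le_four {ℋ : Set EdgeOrderedGraph.{u}}
    (h : orderChromaticNumber ℋ ≠ ⊤) :
    ∃ ℋ' ⊆ ℋ, ℋ'.encard ≤ 4 ∧ orderChromaticNumber ℋ' ≠ ⊤ := by
  obtain ⟨V, hV, G, hG, -⟩ := exists_not_canAvoid h
  -- the classification of homogeneous orders needs five vertices
  obtain ⟨ℋ', hsub, hcard, N, hN⟩ := exists_subfamily (top_mapClasses (k := 1))
    (n := Nat.card V + 5)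
    (fun c => Follows (⊤ : SimpleGraph (Fin 1 × Fin _)) completeEdge (CompleteLt c))
    (fun ℓ hℓ hom => exists_follows_completeLt hℓ hom (by omega))
    (fun c ℓ ℓ' hℓ hℓ' => contains_of_follows exists_completeEdge_eq (completeLt_trichotomy c)
      hℓ hℓ')
    (not_canAvoid_top hG (by omega))
  refine ⟨ℋ', hsub, by simpa using hcard, ne_top_of_le_ne_top ?_ (orderChromaticNumber_le hN)⟩
  have := SimpleGraph.chromaticNumber_le_iff_colorable.2
    (SimpleGraph.colorable_of_fintype (⊤ : SimpleGraph (Fin 1 × Fin N)))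
  exact ne_top_of_le_ne_top (ENat.natCast_ne_top _) this

theorem orderChromaticNumber_eq_of_subset {ℋ ℋ' : Set EdgeOrderedGraph.{u}} {k N : ℕ}
    (h : orderChromaticNumber ℋ = k) (hsub : ℋ' ⊆ ℋ)
    (hN : ¬ CanAvoid (multipartite k N) ℋ') : orderChromaticNumber ℋ' = k :=
  le_antisymm ((orderChromaticNumber_le hN).trans (chromaticNumber_multipartite_le k N))
    (h ▸ orderChromaticNumber_anti hsub)

theorem exists_subfamily_le_eighty {ℋ : Set EdgeOrderedGraph.{u}}
    (h : orderChromaticNumber ℋ = (3 : ℕ)) :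
    ∃ ℋ' ⊆ ℋ, ℋ'.encard ≤ (80 : ℕ) ∧ orderChromaticNumber ℋ' = (3 : ℕ) := by
  obtain ⟨n, hn⟩ := exists_not_canAvoid_multipartite h
  -- the classification of homogeneous orders needs three vertices in each class
  obtain ⟨ℋ', hsub, hcard, N, hN⟩ := exists_subfamily (multipartite_mapClasses (k := 3))
    (n := n + 3)
    (fun c => Follows (multipartite 3 _) tripartiteEdge (normalOrder c).Lt)
    (fun ℓ hℓ hom => exists_follows_normalOrder hℓ hom
      (Fin.mk_lt_mk.2 (by omega : 0 < 1) : (⟨0, by omega⟩ : Fin (n + 3)) < ⟨1, by omega⟩)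
      (Fin.mk_lt_mk.2 (by omega : 1 < 2) : (⟨1, by omega⟩ : Fin (n + 3)) < ⟨2, by omega⟩))
    (fun c ℓ ℓ' hℓ hℓ' => contains_of_follows exists_tripartiteEdge_eq
      (TripartiteOrder.lt_trichotomy (normalOrder_injective c)) hℓ hℓ')
    (hn _ (by omega))
  have h80 : Nat.card ((Fin 6 → Bool) ⊕ (Fin 4 → Bool)) = 80 := by simp
  exact ⟨ℋ', hsub, h80 ▸ hcard, orderChromaticNumber_eq_of_subset h hsub hN⟩

/-- The full comparison pattern of a labelling: which comparisons hold between edges with vertices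
in given classes, and with given relative positions of their vertices within the classes. For a
homogeneous labelling, it determines all comparisons. -/
def pattern {k n : ℕ} (ℓ : Sym2 (Fin k × Fin n) → ℕ) :
    (Fin 4 → Fin k) × (Fin 4 → Fin 4 → Prop) → Prop :=
  fun x => ∃ p : Fin 4 → Fin n, (∀ s t, x.1 s = x.1 t → (p s < p t ↔ x.2 s t)) ∧
    ℓ s((x.1 0, p 0), (x.1 1, p 1)) < ℓ s((x.1 2, p 2), (x.1 3, p 3))

theorem lt_iff_of_pattern_eq {k n : ℕ} {ℓ ℓ' : Sym2 (Fin k × Fin n) → ℕ} (hom' : Homogeneous ℓ')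
    (h : pattern ℓ = pattern ℓ') (e e' : Sym2 (Fin k × Fin n)) (hlt : ℓ e < ℓ e') :
    ℓ' e < ℓ' e' := by
  induction e using Sym2.ind with
  | _ x y =>
  induction e' using Sym2.ind with
  | _ z w =>
  let c : Fin 4 → Fin k := ![x.1, y.1, z.1, w.1]
  let p : Fin 4 → Fin n := ![x.2, y.2, z.2, w.2]
  have h' : pattern ℓ (c, fun s t => p s < p t) := ⟨p, fun _ _ _ => Iff.rfl, hlt⟩
  rw [h] at h'
  obtain ⟨q, hq, hlt'⟩ := h'
  exact (hom' c q p hq).1 hlt'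

theorem exists_subfamily_le_card {ℋ : Set EdgeOrderedGraph.{u}} {k : ℕ}
    (h : orderChromaticNumber ℋ = k) :
    ∃ ℋ' ⊆ ℋ, ℋ'.encard ≤ Nat.card ((Fin 4 → Fin k) × (Fin 4 → Fin 4 → Prop) → Prop) ∧
      orderChromaticNumber ℋ' = k := by
  obtain ⟨n, hn⟩ := exists_not_canAvoid_multipartite h
  obtain ⟨ℋ', hsub, hcard, N, hN⟩ := exists_subfamily (multipartite_mapClasses (k := k)) (n := n)
    (fun c ℓ => Homogeneous ℓ ∧ pattern ℓ = c) (fun ℓ _ hom => ⟨_, hom, rfl⟩)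
    (fun c ℓ ℓ' hℓ hℓ' hc hc' => ofLabel_contains_ofLabel hℓ' hℓ (SimpleGraph.Copy.id _)
      fun e _ e' _ hlt => by
        have := lt_iff_of_pattern_eq hc'.1 (hc.2.trans hc'.2.symm) e e' hlt
        have hid : ∀ e : Sym2 (Fin k × Fin n), e.map (SimpleGraph.Copy.id (multipartite k n)) = e :=
          fun e => congrFun Sym2.map_id e
        rwa [hid, hid])
    (hn n le_rfl)
  exact ⟨ℋ', hsub, hcard, orderChromaticNumber_eq_of_subset h hsub hN⟩

end OrderChromatic

open OrderChromatic

theorem corollary2p6 :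
    -- monotonicity under taking subfamilies
    (∀ ℋ ℋ' : Set EdgeOrderedGraph.{u}, (∀ H ∈ ℋ, H.HasEdge) → ℋ' ⊆ ℋ →
      orderChromaticNumber ℋ ≤ orderChromaticNumber ℋ') ∧
    -- families of order chromatic number 2
    (∀ ℋ : Set EdgeOrderedGraph.{u}, (∀ H ∈ ℋ, H.HasEdge) →
      (orderChromaticNumber ℋ = 2 ↔ ∃ G ∈ ℋ, orderChromaticNumber {G} = 2)) ∧
    -- single graphs of order chromatic number 2
    (∀ (G : EdgeOrderedGraph.{u}) (n : ℕ), G.HasEdge → Nat.card G.V = n →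
      (orderChromaticNumber {G} = 2 ↔ (canonicalBipartite n).Contains G)) ∧
    -- finiteness is witnessed by at most four members
    (∀ ℋ : Set EdgeOrderedGraph.{u}, (∀ H ∈ ℋ, H.HasEdge) → orderChromaticNumber ℋ ≠ ⊤ →
      ∃ ℋ' ⊆ ℋ, ℋ'.encard ≤ 4 ∧ orderChromaticNumber ℋ' ≠ ⊤) ∧
    -- the value `k` is witnessed by at most `c k` members, and `c 3 = 80` is possible
    (∃ c : ℕ → ℕ, c 3 = 80 ∧ ∀ k : ℕ, 3 ≤ k →
      ∀ ℋ : Set EdgeOrderedGraph.{u}, (∀ H ∈ ℋ, H.HasEdge) →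
        orderChromaticNumber ℋ = (k : ℕ∞) →
          ∃ ℋ' ⊆ ℋ, ℋ'.encard ≤ (c k : ℕ∞) ∧ orderChromaticNumber ℋ' = (k : ℕ∞)) := by
  refine ⟨fun ℋ ℋ' _ h => orderChromaticNumber_anti h, fun ℋ hE => ⟨fun h => ?_, ?_⟩,
    fun G n hE hn => ⟨fun h => ?_, fun h => orderChromaticNumber_singleton_of_contains hE h⟩,
    fun ℋ _ h => exists_subfamily_le_four h,
    fun k => if k = 3 then 80 else Nat.card ((Fin 4 → Fin k) × (Fin 4 → Fin 4 → Prop) → Prop),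
    if_pos rfl, fun k _ ℋ _ h => ?_⟩
  · obtain ⟨G, hG, n, hc⟩ := exists_canonicalBipartite_contains h
    exact ⟨G, hG, orderChromaticNumber_singleton_of_contains (hE G hG) hc⟩
  · rintro ⟨G, hG, h⟩
    exact le_antisymm (h ▸ orderChromaticNumber_anti (Set.singleton_subset_iff.2 hG))
      (two_le_orderChromaticNumber hE)
  · obtain ⟨G', rfl, m, hc⟩ := exists_canonicalBipartite_contains h
    exact canonicalBipartite_contains_of_contains hc hn.le
  · dsimp only
    split_ifs with hk
    · subst hk
      exact exists_subfamily_le_eighty h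
    · exact exists_subfamily_le_card h
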